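/- Let $B$ be a one-dimensional Brownian motion on a complete probability space $(\Omega,\mathcal F,\mathbb P)$ and let $\mathcal F_\tau$ be the $\sigma$-algebra generated by $(B_s)_{0\le s\le\tau}$ and the $\mathbb P$-null sets. Let $r,\mu\in\mathbb R$, $\sigma>0$, $\tau>0$, $\alpha\in(0,1)$, $k\ge 0$, $\gamma>0$, $\delta>0$, $\beta\in[0,1]$, put $\phi:=(\mu-r)/\sigma$ and assume $\phi\neq 0$ and $$\delta>h:=r\alpha+\frac{\alpha\phi^2}{2(1-\alpha)} .$$ Define $Z_\tau:=\exp\bigl(-\phi B_\tau-(r+\tfrac{\phi^2}{2})\tau\bigr)$, $\mathcal Y:=\{Y : Y \text{ is } \mathcal F_\tau\text{-measurable},\ Y\ge 0,\ \mathbb E[Z_\tau Y]\le 1\}$, $U(x):=x^\alpha$ for $x\ge 0$ and $U(x):=-k|x|^\alpha$ for $x<0$, $F(y;\theta):=U(y-\gamma)+\theta y^\alpha$ for $y\ge0$, $\theta\in\mathbb R$, and $\Phi(\theta):=\sup_{Y\in\mathcal Y}\mathbb E[F(Y;\theta)]$. For every $\kappa\in[0,1]$ the map $\theta\mapsto e^{-\delta\tau}\Phi(\kappa\theta)$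 has exactly one fixed point in $\mathbb R$, denoted $\theta^*(\kappa)$. For $\xi\in[0,e^{h\tau}]$ put $\kappa(\xi):=\frac{\beta}{1-(1-\beta)e^{-\delta\tau}\xi}$, which lies in $[0,1]$, and $$G(\xi):=\Bigl\{\mathbb E[Y^\alpha] \;:\; Y\in\operatorname*{arg\,max}_{Y\in\mathcal Y}\mathbb E\bigl[F\bigl(Y;\kappa(\xi)\,\theta^*(\kappa(\xi))\bigr)\bigr]\Bigr\}\subseteq[0,e^{h\tau}].$$ **Theorem.** The set-valued map $G$ has a fixed point in $[0,e^{h\tau}]$, i.e. there is $\hat\xi\in[0,e^{h\tau}]$ with $\hat\xi\in G(\hat\xi)$. Specifically: 1. If $\theta^*(0)>0$, then $G$ has at least one fixed point. 2. If $\theta^*(0)=0$, then the set $\{\mathbb E[Y^\alpha] : Y\in\operatorname{arg\,max}_{Y\in\mathcal Y}\mathbb E[U(Y-\gamma)]\}$ consists of a single number, and this number is the one and only fixed point of $G$. 3. If $\theta^*(0)<0$, and either $\beta<1$ or $\theta^*(1)\neq-(1+k^{1/(1-\alpha)})^{1-\alpha}$, then $G$ has exactly one fixed point. -/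

import Mathlib

open MeasureTheory ProbabilityTheory Set
open scoped NNReal

noncomputable section

namespace PresentBias

/-- The real parameters of the model: the Black-Scholes market (`r`, `μ`, `σ`), the length `τ` of an
evaluation period, and the preference parameters (`α`, `k`, `γ`, `δ`, `β`). -/
structure Params where
  /-- risk free rate -/
  r : ℝ
  /-- drift of the risky asset -/
  μ : ℝ
  /-- volatility of the risky asset -/
  σ : ℝ
  /-- length of an evaluation period -/
  τ : ℝ≥0
  /-- risk aversion / risk seeking exponent -/
  α : ℝ
  /-- loss aversion -/
  k : ℝ
  /-- performance benchmark -/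
  γ : ℝ
  /-- discount rate -/
  δ : ℝ
  /-- myopia level -/
  β : ℝ

namespace Params

variable (p : Params)

/-- Market price of risk `φ = (μ - r) / σ`. -/
def φ : ℝ := (p.μ - p.r) / p.σ

/-- `h = r α + α φ² / (2 (1 - α))`. -/
def h : ℝ := p.r * p.α + p.α * p.φ ^ 2 / (2 * (1 - p.α))

/-- The one-period discount factor `e^{-δτ}`. -/
def disc : ℝ := Real.exp (-p.δ * p.τ)

/-- Piecewise power (S-shaped) utility. -/
def U (x : ℝ) : ℝ := if 0 ≤ x then x ^ p.α else -p.k * |x| ^ p.α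

/-- `F(y; θ) = U(y - γ) + θ y^α`. -/
def F (y θ : ℝ) : ℝ := p.U (y - p.γ) + θ * y ^ p.α

/-- `θ̲ = -(1 + k^{1/(1-α)})^{1-α}`. -/
def thetaLow : ℝ := -(1 + p.k ^ (1 / (1 - p.α))) ^ (1 - p.α)

/-- `κ(ξ) = β / (1 - (1 - β) e^{-δτ} ξ)`. -/
def kappa (ξ : ℝ) : ℝ := p.β / (1 - (1 - p.β) * p.disc * ξ)

end Params

/-- The time-`t` σ-algebra of the filtration generated by `B`, augmented by the `P`-null sets. -/
@[reducible]
def augmented {Ω : Type*} {mΩ : MeasurableSpace Ω} (B : ℝ≥0 → Ω → ℝ) (P : Measure Ω) (t : ℝ≥0) :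
    MeasurableSpace Ω :=
  (⨆ s ∈ Iic t, MeasurableSpace.comap (B s) inferInstance) ⊔
    MeasurableSpace.generateFrom {N : Set Ω | P N = 0}

section

variable {Ω : Type*} [MeasurableSpace Ω] (P : Measure Ω) (B : ℝ≥0 → Ω → ℝ) (p : Params)

/-- The pricing kernel `Z_t = exp(-φ B_t - (r + φ²/2) t)`. -/
def kernelZ (t : ℝ≥0) (ω : Ω) : ℝ :=
  Real.exp (-p.φ * B t ω - (p.r + p.φ ^ 2 / 2) * t)

/-- The set `𝒴` of one-period gross returns: nonnegative `ℱ_τ`-measurable random variables `Y` with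
`E[Z_τ Y] ≤ 1` (in particular this expectation is finite). -/
def returns : Set (Ω → ℝ) :=
  {Y | Measurable[augmented B P p.τ] Y ∧ (∀ ω, 0 ≤ Y ω) ∧
    Integrable (fun ω => kernelZ B p p.τ ω * Y ω) P ∧
    ∫ ω, kernelZ B p p.τ ω * Y ω ∂P ≤ 1}

/-- `argmax_{Y ∈ 𝒴} E[f(Y)]`. -/
def optimizers (f : ℝ → ℝ) : Set (Ω → ℝ) :=
  {Y | Y ∈ returns P B p ∧ ∀ Y' ∈ returns P B p, ∫ ω, f (Y' ω) ∂P ≤ ∫ ω, f (Y ω) ∂P}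

/-- The set of the values `E[Y^α]`, where `Y` ranges over `argmax_{Y ∈ 𝒴} E[f(Y)]`. -/
def optimalMoments (f : ℝ → ℝ) : Set ℝ :=
  (fun Y : Ω → ℝ => ∫ ω, Y ω ^ p.α ∂P) '' optimizers P B p f

/-- `Φ(θ) = sup_{Y ∈ 𝒴} E[F(Y; θ)]`. -/
def Phi (θ : ℝ) : ℝ :=
  sSup ((fun Y : Ω → ℝ => ∫ ω, p.F (Y ω) θ ∂P) '' returns P B p)

/-- `θ*(κ)`: the fixed point of `θ ↦ e^{-δτ} Φ(κ θ)`. (That there is exactly one for every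
`κ ∈ [0,1]` is part of the theorem.) -/
def thetaStar (κ : ℝ) : ℝ :=
  Classical.epsilon fun θ : ℝ => θ = p.disc * Phi P B p (κ * θ)

/-- The set-valued map `G`. -/
def G (ξ : ℝ) : Set ℝ :=
  optimalMoments P B p fun y => p.F y (p.kappa ξ * thetaStar P B p (p.kappa ξ))

end

end PresentBias

end

/-!
`Φ` is convex and Lipschitz with constant `e^{hτ}`, being a supremum of affine functions of `θ`
whose slopes `E[Y^α]` lie in `[0, e^{hτ}]`. The key fact is that the optimal moments at `θ` are
exactly the subgradients of `Φ` at `θ`. An optimal moment is a subgradient by definition of `Φ`.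
Conversely, the supremum is dual to the pointwise maximization of the Lagrangian
`F(y; θ) - l Z_τ y`. If its maximizer is almost surely unique, comparing with the duals of slightly
perturbed `θ` and `l` leaves the moment of that maximizer as the only subgradient. Otherwise
`l = 0`, which forces `θ = θ̲`, and the Lagrangian is maximal at `0` and at a positive point; as
`Z_τ` has no atoms, digital payoffs realize every subgradient.

So `G(ξ)` is the subdifferential of `Φ` at `κ(ξ) θ*(κ(ξ))`. Since `e^{-δτ} e^{hτ} < 1`, `θ*(κ)` is
the fixed point of a contraction and depends continuously on `κ`; hence `G` has nonempty interval
values and a closed graph, and Kakutani's theorem in dimension one applies. If `θ*(0) = 0`, then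
`θ*` vanishes identically and `G` is constant. If `θ*(0) < 0`, then `κ ↦ κ θ*(κ)` is decreasing, so
`G` is decreasing in `ξ` and has only one fixed point.
-/

noncomputable section

open Filter Topology

namespace PresentBias

section RealPowers

variable {a x y : ℝ}

lemma le_rpow_of_mul_le_mul_rpow {C : ℝ} (ha : a < 1) (hx : 0 < x) (hC : 0 ≤ C) (hy : 0 ≤ y)
    (h : x * y ≤ C * y ^ a) : y ≤ (C / x) ^ (1 / (1 - a)) := by
  rcases hy.eq_or_lt with rfl | hy0
  · exact Real.rpow_nonneg (div_nonneg hC hx.le) _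
  have h1 : 0 < 1 - a := sub_pos.2 ha
  have hpow : y ^ (1 - a) ≤ C / x := by
    rw [Real.rpow_sub hy0, Real.rpow_one, div_le_div_iff₀ (Real.rpow_pos_of_pos hy0 _) hx]
    linarith
  calc y = (y ^ (1 - a)) ^ (1 / (1 - a)) := by
        rw [← Real.rpow_mul hy, mul_one_div_cancel h1.ne', Real.rpow_one]
    _ ≤ _ := Real.rpow_le_rpow (Real.rpow_nonneg hy _) hpow (by positivity)

lemma exists_pos_mul_lt_rpow (ha : a < 1) (C : ℝ) : ∃ t : ℝ, 0 < t ∧ C * t < t ^ a := by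
  have hM : 0 < |C| + 1 := by positivity
  set t := (|C| + 1) ^ (a - 1)⁻¹ with ht_def
  have ht : 0 < t := Real.rpow_pos_of_pos hM _
  refine ⟨t, ht, ?_⟩
  calc C * t < (|C| + 1) * t :=
        mul_lt_mul_of_pos_right ((le_abs_self C).trans_lt (lt_add_one _)) ht
    _ = t ^ (a - 1) * t := by rw [ht_def, Real.rpow_inv_rpow hM.le (sub_ne_zero.2 ha.ne)]
    _ = t ^ a := by rw [← Real.rpow_add_one ht.ne', sub_add_cancel]

lemma add_rpow_le_rpow_mul_one_add (ha : a ∈ Icc (0 : ℝ) 1) (hx : 0 < x) (hy : 0 ≤ y) :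
    (x + y) ^ a ≤ x ^ a * (1 + a * (y / x)) := by
  have hyx : 0 ≤ y / x := div_nonneg hy hx.le
  rw [show x + y = x * (1 + y / x) by field_simp, Real.mul_rpow hx.le (by positivity)]
  exact mul_le_mul_of_nonneg_left
    (rpow_one_add_le_one_add_mul_self (by linarith) ha.1 ha.2) (Real.rpow_nonneg hx.le _)

lemma rpow_le_mul_weighted_mean {z K : ℝ} (ha : a ∈ Ico (0 : ℝ) 1) (hy : 0 ≤ y) (hz : 0 < z)
    (hK : 0 < K) :
    y ^ a ≤ K * (a * (z * y) + (1 - a) * (z ^ (-(a / (1 - a))) / K ^ (1 / (1 - a)))) := by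
  have h1 : 0 < 1 - a := sub_pos.2 ha.2
  have : 0 < z ^ a := Real.rpow_pos_of_pos hz _
  have hmean := Real.geom_mean_le_arith_mean2_weighted (w₁ := a) (w₂ := 1 - a) (p₁ := z * y)
    (p₂ := z ^ (-(a / (1 - a))) / K ^ (1 / (1 - a))) ha.1 h1.le (by positivity)
    (by positivity) (by ring)
  refine le_trans (le_of_eq ?_) (mul_le_mul_of_nonneg_left hmean hK.le)
  rw [Real.mul_rpow hz.le hy, Real.div_rpow (by positivity) (by positivity),
    ← Real.rpow_mul hz.le, ← Real.rpow_mul hK.le, one_div_mul_cancel h1.ne', Real.rpow_one,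
    neg_mul, div_mul_cancel₀ _ h1.ne', Real.rpow_neg hz.le]
  field_simp

lemma bddAbove_setOf_le_mul_rpow_sub_mul {ν : ℝ} (ha : a < 1) (σ : ℝ) (hν : 0 < ν) (c : ℝ) :
    BddAbove {y : ℝ | 0 ≤ y ∧ c ≤ σ * y ^ a - ν * y} := by
  refine ⟨max (|c| / (ν / 2)) ((|σ| / (ν / 2)) ^ (1 / (1 - a))), fun y ⟨hy, hc⟩ => ?_⟩
  rcases le_or_gt (ν / 2 * y) |c| with h | h
  · exact le_max_of_le_left ((le_div_iff₀' (half_pos hν)).2 h)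
  · refine le_max_of_le_right (le_rpow_of_mul_le_mul_rpow ha (half_pos hν) (abs_nonneg σ) hy ?_)
    linarith [neg_abs_le c, mul_le_mul_of_nonneg_right (le_abs_self σ) (Real.rpow_nonneg hy a)]

end RealPowers

section Subdifferential

/-- The subdifferential of `f : ℝ → ℝ` at `x`: the slopes of the affine functions that support `f`
from below at `x`. -/
def subdifferential (f : ℝ → ℝ) (x : ℝ) : Set ℝ :=
  {s | ∀ y, f x + s * (y - x) ≤ f y}

variable {f : ℝ → ℝ} {x y s t : ℝ}

lemma subdifferential_mono (hxy : x < y) (hs : s ∈ subdifferential f x)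
    (ht : t ∈ subdifferential f y) : s ≤ t := by
  have h1 := hs y
  have h2 := ht x
  nlinarith

lemma ordConnected_subdifferential (f : ℝ → ℝ) (x : ℝ) : (subdifferential f x).OrdConnected := by
  refine ⟨fun s hs t ht u hu y => ?_⟩
  rcases le_total x y with h | h
  · linarith [ht y, mul_le_mul_of_nonneg_right hu.2 (sub_nonneg.2 h)]
  · linarith [hs y, mul_le_mul_of_nonpos_right hu.1 (sub_nonpos.2 h)]

lemma isClosed_setOf_mem_subdifferential (hf : Continuous f) :
    IsClosed {q : ℝ × ℝ | q.2 ∈ subdifferential f q.1} := by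
  have : {q : ℝ × ℝ | q.2 ∈ subdifferential f q.1} =
      ⋂ y, {q : ℝ × ℝ | f q.1 + q.2 * (y - q.1) ≤ f y} := by
    ext q
    simp [subdifferential]
  rw [this]
  exact isClosed_iInter fun y => isClosed_le (by fun_prop) continuous_const

lemma subdifferential_subset_Icc {L : ℝ} (hf : Monotone f)
    (hL : ∀ x y, x ≤ y → f y ≤ f x + L * (y - x)) (x : ℝ) : subdifferential f x ⊆ Icc 0 L := by
  intro s hs
  have hleft := hs (x - 1)
  have hright := hs (x + 1)
  have hmono := hf (show x - 1 ≤ x by linarith)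
  have hgrowth := hL x (x + 1) (by linarith)
  constructor <;> linarith

lemma exists_mem_self_of_isClosed_graph {a b : ℝ} (hab : a ≤ b) {S : ℝ → Set ℝ}
    (hgraph : IsClosed {q : ℝ × ℝ | q.1 ∈ Icc a b ∧ q.2 ∈ S q.1})
    (hS : ∀ x ∈ Icc a b, (S x).OrdConnected) (hne : ∀ x ∈ Icc a b, (S x ∩ Icc a b).Nonempty) :
    ∃ x ∈ Icc a b, x ∈ S x := by
  set Γ := {q : ℝ × ℝ | q.1 ∈ Icc a b ∧ q.2 ∈ S q.1}
  have hclosed : ∀ C : Set (ℝ × ℝ), IsClosed C →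
      IsClosed (Prod.fst '' (Icc a b ×ˢ Icc a b ∩ (Γ ∩ C))) := fun C hC =>
    (((isCompact_Icc.prod isCompact_Icc).inter_right (hgraph.inter hC)).image
      continuous_fst).isClosed
  have hmem : ∀ x ∈ Icc a b, ∃ m ∈ Icc a b, (x, m) ∈ Γ := fun x hx =>
    let ⟨m, hmS, hm⟩ := hne x hx
    ⟨m, hm, hx, hmS⟩
  obtain ⟨x, hx, ⟨⟨x₁, m₁⟩, ⟨-, ⟨-, hm₁⟩, hle₁⟩, rfl⟩, ⟨⟨x₂, m₂⟩, ⟨-, ⟨-, hm₂⟩, hle₂⟩, rfl⟩⟩ :=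
    isPreconnected_closed_iff.1 (isPreconnected_Icc (a := a) (b := b)) _ _
      (hclosed _ (isClosed_le continuous_fst continuous_snd))
      (hclosed _ (isClosed_le continuous_snd continuous_fst))
      (fun x hx => by
        obtain ⟨m, hm, hΓ⟩ := hmem x hx
        exact (le_total x m).imp (fun h => ⟨(x, m), ⟨⟨hx, hm⟩, hΓ, h⟩, rfl⟩)
          fun h => ⟨(x, m), ⟨⟨hx, hm⟩, hΓ, h⟩, rfl⟩)
      (by
        obtain ⟨m, hm, hΓ⟩ := hmem a (left_mem_Icc.2 hab)
        exact ⟨a, left_mem_Icc.2 hab, (a, m), ⟨⟨left_mem_Icc.2 hab, hm⟩, hΓ, hm.1⟩, rfl⟩)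
      (by
        obtain ⟨m, hm, hΓ⟩ := hmem b (right_mem_Icc.2 hab)
        exact ⟨b, right_mem_Icc.2 hab, (b, m), ⟨⟨right_mem_Icc.2 hab, hm⟩, hΓ, hm.2⟩, rfl⟩)
  exact ⟨x₂, hx, (hS x₂ hx).out hm₂ hm₁ ⟨hle₂, hle₁⟩⟩

lemma exists_mem_subdifferential_comp_self {a b : ℝ} (hab : a ≤ b) (hf : Continuous f)
    {t : ℝ → ℝ} (ht : ContinuousOn t (Icc a b)) (hne : ∀ x, (subdifferential f x).Nonempty)
    (hsub : ∀ x, subdifferential f x ⊆ Icc a b) :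
    ∃ x ∈ Icc a b, x ∈ subdifferential f (t x) := by
  refine exists_mem_self_of_isClosed_graph hab ?_ (fun x _ => ordConnected_subdifferential f (t x))
    fun x _ => let ⟨s, hs⟩ := hne (t x); ⟨s, hs, hsub _ hs⟩
  have hcont : ContinuousOn (fun q : ℝ × ℝ => (t q.1, q.2)) (Icc a b ×ˢ univ) :=
    (ht.comp continuousOn_fst fun q hq => hq.1).prodMk continuousOn_snd
  convert hcont.preimage_isClosed_of_isClosed (isClosed_Icc.prod isClosed_univ)
    (isClosed_setOf_mem_subdifferential hf) using 1
  ext q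
  simp

end Subdifferential

section ScaledFixedPoint

variable {f : ℝ → ℝ} {K : ℝ≥0} {κ κ' θ θ' : ℝ}

lemma contractingWith_comp_mul (hK : K < 1) (hf : LipschitzWith K f) (hκ : |κ| ≤ 1) :
    ContractingWith K fun θ => f (κ * θ) := by
  refine ⟨hK, LipschitzWith.of_dist_le_mul fun x y => (hf.dist_le_mul _ _).trans ?_⟩
  rw [Real.dist_eq, ← mul_sub, abs_mul, Real.dist_eq]
  gcongr
  exact mul_le_of_le_one_left (abs_nonneg _) hκ

lemma existsUnique_eq_comp_mul (hK : K < 1) (hf : LipschitzWith K f) (hκ : |κ| ≤ 1) :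
    ∃! θ, θ = f (κ * θ) := by
  have hc := contractingWith_comp_mul hK hf hκ
  exact ⟨_, hc.fixedPoint_isFixedPt.symm, fun θ hθ => hc.fixedPoint_unique hθ.symm⟩

lemma abs_sub_le_of_eq_comp_mul (hf : LipschitzWith K f) (hκ : |κ| ≤ 1) (hθ : θ = f (κ * θ))
    (hθ' : θ' = f (κ' * θ')) : (1 - K) * |θ - θ'| ≤ K * (|κ - κ'| * |θ'|) := by
  have hlip : |θ - θ'| ≤ K * |κ * θ - κ' * θ'| := by
    simpa only [Real.dist_eq, ← hθ, ← hθ'] using hf.dist_le_mul (κ * θ) (κ' * θ')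
  have hsplit : |κ * θ - κ' * θ'| ≤ |θ - θ'| + |κ - κ'| * |θ'| :=
    calc |κ * θ - κ' * θ'| = |κ * (θ - θ') + (κ - κ') * θ'| := by ring_nf
      _ ≤ |κ * (θ - θ')| + |(κ - κ') * θ'| := abs_add_le _ _
      _ ≤ |θ - θ'| + |κ - κ'| * |θ'| := by
        rw [abs_mul, abs_mul]
        gcongr
        exact mul_le_of_le_one_left (abs_nonneg _) hκ
  linarith [mul_le_mul_of_nonneg_left hsplit K.coe_nonneg]

lemma continuousOn_of_eq_comp_mul (hK : K < 1) (hf : LipschitzWith K f) {t : ℝ → ℝ} {S : Set ℝ}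
    (hS : ∀ κ ∈ S, |κ| ≤ 1) (ht : ∀ κ ∈ S, t κ = f (κ * t κ)) : ContinuousOn t S := by
  intro κ₀ hκ₀
  have hpos : (0 : ℝ) < 1 - K := sub_pos.2 (by exact_mod_cast hK)
  have hlim : Tendsto (fun κ : ℝ => K * (|κ - κ₀| * |t κ₀|) / (1 - K)) (𝓝[S] κ₀) (𝓝 0) := by
    have : Continuous fun κ : ℝ => (K : ℝ) * (|κ - κ₀| * |t κ₀|) / (1 - K) := by fun_prop
    simpa using (this.tendsto κ₀).mono_left nhdsWithin_le_nhds
  rw [ContinuousWithinAt, tendsto_iff_dist_tendsto_zero]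
  refine squeeze_zero' (Eventually.of_forall fun _ => dist_nonneg) ?_ hlim
  filter_upwards [self_mem_nhdsWithin] with κ hκ
  rw [le_div_iff₀ hpos, mul_comm, Real.dist_eq]
  exact abs_sub_le_of_eq_comp_mul hf (hS κ hκ) (ht κ hκ) (ht κ₀ hκ₀)

lemma neg_of_eq_comp_mul (hK : K ≤ 1) (hf : LipschitzWith K f) (h0 : f 0 < 0) (hκ : |κ| ≤ 1)
    (hθ : θ = f (κ * θ)) : θ < 0 := by
  by_contra! hnonneg
  have hlip : f (κ * θ) ≤ f 0 + K * |κ * θ| := by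
    simpa [Real.dist_eq] using hf.le_add_mul (κ * θ) 0
  have hle : K * |κ * θ| ≤ 1 * (1 * θ) := by
    rw [abs_mul, abs_of_nonneg hnonneg]
    gcongr
    exact_mod_cast hK
  linarith

lemma mul_lt_mul_of_eq_comp_mul (hK : K ≤ 1) (hf : LipschitzWith K f) (hκ' : κ' ∈ Icc (0 : ℝ) 1)
    (hlt : κ < κ') (hneg : θ < 0) (hθ : θ = f (κ * θ)) (hθ' : θ' = f (κ' * θ')) :
    κ' * θ' < κ * θ := by
  by_contra! hle
  have hlip : θ' ≤ θ + K * (κ' * θ' - κ * θ) := by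
    simpa only [Real.dist_eq, abs_of_nonneg (sub_nonneg.2 hle), ← hθ, ← hθ'] using
      hf.le_add_mul (κ' * θ') (κ * θ)
  have hcontr : κ' * (K * (κ' * θ' - κ * θ)) ≤ 1 * (1 * (κ' * θ' - κ * θ)) := by
    have := sub_nonneg.2 hle
    gcongr
    · exact hκ'.2
    · exact_mod_cast hK
  linarith [mul_le_mul_of_nonneg_left hlip hκ'.1, mul_neg_of_pos_of_neg (sub_pos.2 hlt) hneg]

end ScaledFixedPoint

section Distribution

variable {Ω : Type*} {mΩ : MeasurableSpace Ω} {μ : Measure Ω} {X f : Ω → ℝ}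

lemma tendsto_setIntegral_setOf_le_atTop (hX : AEMeasurable X μ) (hf : Integrable f μ) :
    Tendsto (fun c => ∫ ω in {ω | X ω ≤ c}, f ω ∂μ) atTop (𝓝 (∫ ω, f ω ∂μ)) := by
  have hunion : ⋃ c, {ω | X ω ≤ c} = univ :=
    eq_univ_of_forall fun ω => mem_iUnion.2 ⟨X ω, le_refl (X ω)⟩
  simpa only [hunion, setIntegral_univ] using
    tendsto_setIntegral_of_monotone₀ (s := fun c => {ω | X ω ≤ c})
      (fun c => hX.nullMeasurableSet_preimage measurableSet_Iic)
      (fun c c' hc ω hω => le_trans (mem_ofPred.1 hω) hc) hf.integrableOn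

lemma continuous_cdf {ν : Measure ℝ} [IsProbabilityMeasure ν] (hν : ∀ c, ν {c} = 0) :
    Continuous (cdf ν) := by
  have : NullSingletonClass ν := ⟨hν⟩
  have hcdf : cdf ν = fun c => ∫ _ in Iic c, (1 : ℝ) ∂ν := by
    funext c
    simp [cdf_eq_real]
  rw [hcdf, continuous_iff_continuousAt]
  exact fun c => (IntegrableOn.continuousOn_Iic_primitive_Iic
    (integrable_const (1 : ℝ)).integrableOn).continuousAt (Iic_mem_nhds (lt_add_one c))

lemma exists_measureReal_setOf_le_eq [IsProbabilityMeasure μ] (hX : AEMeasurable X μ)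
    (hatom : ∀ c, μ {ω | X ω = c} = 0) {q : ℝ} (hq : q ∈ Ioo (0 : ℝ) 1) :
    ∃ c, μ.real {ω | X ω ≤ c} = q := by
  have := Measure.isProbabilityMeasure_map hX
  have hcont : Continuous (cdf (μ.map X)) := continuous_cdf fun c => by
    rw [Measure.map_apply_of_aemeasurable hX (measurableSet_singleton c)]
    exact hatom c
  obtain ⟨c, hc⟩ := mem_range_of_exists_le_of_exists_ge hcont
    ((tendsto_cdf_atBot (μ.map X)).eventually_le_const hq.1).exists
    ((tendsto_cdf_atTop (μ.map X)).eventually_const_le hq.2).exists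
  rw [cdf_eq_real, map_measureReal_apply_of_aemeasurable hX measurableSet_Iic] at hc
  exact ⟨c, hc⟩

end Distribution

namespace Params

/-- The standing assumptions on the preference parameters. -/
structure Admissible (p : Params) : Prop where
  α_mem : p.α ∈ Ioo (0 : ℝ) 1
  k_nonneg : 0 ≤ p.k
  γ_pos : 0 < p.γ

/-- The maximizers over `[0, ∞)` of the Lagrangian `y ↦ F(y; θ) - x y`. -/
def argmaxSet (p : Params) (θ x : ℝ) : Set ℝ :=
  {y | 0 ≤ y ∧ ∀ y', 0 ≤ y' → p.F y' θ - x * y' ≤ p.F y θ - x * y}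

/-- A selection of maximizers over `[0, ∞)` of the Lagrangian `y ↦ F(y; θ) - x y`. -/
def argmaxSel (p : Params) (θ x : ℝ) : ℝ :=
  Classical.epsilon fun y => y ∈ p.argmaxSet θ x

variable {p : Params} {θ x y y' : ℝ}

lemma U_of_nonneg (hx : 0 ≤ x) : p.U x = x ^ p.α := if_pos hx

lemma U_of_nonpos (hα : p.α ≠ 0) (hx : x ≤ 0) : p.U x = -p.k * (-x) ^ p.α := by
  rcases hx.lt_or_eq with h | rfl
  · rw [U, if_neg (not_le.2 h), abs_of_neg h]
  · simp [U, Real.zero_rpow hα]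

lemma continuous_U (hα : 0 < p.α) : Continuous p.U := by
  have hpow : Continuous fun y : ℝ => y ^ p.α := Real.continuous_rpow_const hα.le
  refine Continuous.if_le hpow (continuous_const.mul (hpow.comp continuous_abs))
    continuous_const continuous_id fun x hx => ?_
  simp [← hx, Real.zero_rpow hα.ne']

lemma continuous_F (hα : 0 < p.α) : Continuous fun q : ℝ × ℝ => p.F q.1 q.2 :=
  ((continuous_U hα).comp (continuous_fst.sub continuous_const)).add
    (continuous_snd.mul ((Real.continuous_rpow_const hα.le).comp continuous_fst))

lemma F_add (p : Params) (y θ c : ℝ) : p.F y (θ + c) = p.F y θ + c * y ^ p.α := by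
  unfold F
  ring

lemma F_of_benchmark_le (hy : p.γ ≤ y) : p.F y θ = (y - p.γ) ^ p.α + θ * y ^ p.α := by
  rw [F, U_of_nonneg (sub_nonneg.2 hy)]

lemma F_of_le_benchmark (hα : p.α ≠ 0) (hy : y ≤ p.γ) :
    p.F y θ = -p.k * (p.γ - y) ^ p.α + θ * y ^ p.α := by
  rw [F, U_of_nonpos hα (sub_nonpos.2 hy), neg_sub]

lemma F_zero (hα : p.α ≠ 0) (hγ : 0 ≤ p.γ) (θ : ℝ) : p.F 0 θ = -p.k * p.γ ^ p.α := by
  simp [F_of_le_benchmark hα hγ, Real.zero_rpow hα]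

lemma F_benchmark (hα : p.α ≠ 0) (θ : ℝ) : p.F p.γ θ = θ * p.γ ^ p.α := by
  simp [F_of_benchmark_le le_rfl, Real.zero_rpow hα]

namespace Admissible

lemma one_sub_α_pos (hp : p.Admissible) : 0 < 1 - p.α := sub_pos.2 hp.α_mem.2

lemma α_ne_zero (hp : p.Admissible) : p.α ≠ 0 := hp.α_mem.1.ne'

lemma abs_U_sub_benchmark_le (hp : p.Admissible) (hy : 0 ≤ y) :
    |p.U (y - p.γ)| ≤ p.k * p.γ ^ p.α + y ^ p.α := by
  have hkγ : 0 ≤ p.k * p.γ ^ p.α := mul_nonneg hp.k_nonneg (Real.rpow_nonneg hp.γ_pos.le _)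
  rcases le_total p.γ y with h | h
  · rw [U_of_nonneg (sub_nonneg.2 h), abs_of_nonneg (Real.rpow_nonneg (sub_nonneg.2 h) _)]
    linarith [Real.rpow_le_rpow (sub_nonneg.2 h) (sub_le_self y hp.γ_pos.le) hp.α_mem.1.le]
  · rw [U_of_nonpos hp.α_ne_zero (sub_nonpos.2 h), neg_sub, neg_mul, abs_neg,
      abs_of_nonneg (mul_nonneg hp.k_nonneg (Real.rpow_nonneg (sub_nonneg.2 h) _))]
    linarith [Real.rpow_nonneg hy p.α, mul_le_mul_of_nonneg_left
      (Real.rpow_le_rpow (sub_nonneg.2 h) (sub_le_self p.γ hy) hp.α_mem.1.le) hp.k_nonneg]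

lemma U_sub_benchmark_le (hp : p.Admissible) (hy : 0 ≤ y) :
    p.U (y - p.γ) ≤ -p.k * p.γ ^ p.α + (1 + p.k) * y ^ p.α := by
  rcases le_total p.γ y with h | h
  · rw [U_of_nonneg (sub_nonneg.2 h)]
    linarith [Real.rpow_le_rpow (sub_nonneg.2 h) (sub_le_self y hp.γ_pos.le) hp.α_mem.1.le,
      mul_le_mul_of_nonneg_left (Real.rpow_le_rpow hp.γ_pos.le h hp.α_mem.1.le) hp.k_nonneg]
  · have hsubadd : p.γ ^ p.α ≤ (p.γ - y) ^ p.α + y ^ p.α := by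
      simpa using Real.rpow_add_le_add_rpow (sub_nonneg.2 h) hy hp.α_mem.1.le hp.α_mem.2.le
    rw [U_of_nonpos hp.α_ne_zero (sub_nonpos.2 h), neg_sub]
    linarith [Real.rpow_nonneg hy p.α, mul_le_mul_of_nonneg_left hsubadd hp.k_nonneg]

lemma F_le (hp : p.Admissible) (θ : ℝ) (hy : 0 ≤ y) :
    p.F y θ ≤ p.F 0 θ + (1 + p.k + |θ|) * y ^ p.α := by
  rw [F_zero hp.α_ne_zero hp.γ_pos.le, F]
  linarith [hp.U_sub_benchmark_le hy,
    mul_le_mul_of_nonneg_right (le_abs_self θ) (Real.rpow_nonneg hy p.α)]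

lemma le_of_F_zero_le (hp : p.Admissible) (hx : 0 < x) (hy : 0 ≤ y)
    (h : p.F 0 θ ≤ p.F y θ - x * y) : y ≤ ((1 + p.k + |θ|) / x) ^ (1 / (1 - p.α)) := by
  have := hp.k_nonneg
  exact le_rpow_of_mul_le_mul_rpow hp.α_mem.2 hx (by positivity) hy (by linarith [hp.F_le θ hy])

lemma le_of_mem_argmaxSet (hp : p.Admissible) (hx : 0 < x) (hy : y ∈ p.argmaxSet θ x) :
    y ≤ ((1 + p.k + |θ|) / x) ^ (1 / (1 - p.α)) :=
  hp.le_of_F_zero_le hx hy.1 (by simpa using hy.2 0 le_rfl)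

lemma argmaxSet_nonempty (hp : p.Admissible) (hx : 0 < x) : (p.argmaxSet θ x).Nonempty := by
  set b := ((1 + p.k + |θ|) / x) ^ (1 / (1 - p.α))
  have hb : 0 ∈ Icc 0 b := by
    have := hp.k_nonneg
    exact left_mem_Icc.2 (Real.rpow_nonneg (by positivity) _)
  have hcont : Continuous fun y => p.F y θ - x * y :=
    ((continuous_F hp.α_mem.1).comp (continuous_id.prodMk continuous_const)).sub
      (continuous_const.mul continuous_id)
  obtain ⟨y, hy, hmax⟩ := isCompact_Icc.exists_isMaxOn ⟨0, hb⟩ hcont.continuousOn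
  refine ⟨y, hy.1, fun y' hy' => ?_⟩
  rcases le_total (p.F 0 θ) (p.F y' θ - x * y') with h | h
  · exact hmax ⟨hy', hp.le_of_F_zero_le hx hy' h⟩
  · exact (h.trans_eq (by ring)).trans (hmax hb)

end Admissible

lemma le_of_mem_argmaxSet_of_lt {x' : ℝ} (hx : x < x') (hy : y ∈ p.argmaxSet θ x)
    (hy' : y' ∈ p.argmaxSet θ x') : y' ≤ y := by
  have h1 := hy.2 y' hy'.1
  have h2 := hy'.2 y hy.1
  nlinarith

lemma mem_argmaxSet_of_tendsto (hα : 0 < p.α) {ι : Type*} {l : Filter ι} [l.NeBot]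
    {t u v : ι → ℝ} (ht : Tendsto t l (𝓝 θ)) (hu : Tendsto u l (𝓝 x)) (hv : Tendsto v l (𝓝 y))
    (h : ∀ᶠ i in l, v i ∈ p.argmaxSet (t i) (u i)) : y ∈ p.argmaxSet θ x := by
  have hF : ∀ {w : ι → ℝ} {w₀ : ℝ}, Tendsto w l (𝓝 w₀) →
      Tendsto (fun i => p.F (w i) (t i) - u i * w i) l (𝓝 (p.F w₀ θ - x * w₀)) := fun hw =>
    (((continuous_F hα).tendsto _).comp (hw.prodMk_nhds ht)).sub (hu.mul hw)
  refine ⟨ge_of_tendsto hv (h.mono fun i hi => hi.1), fun y' hy' => ?_⟩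
  exact le_of_tendsto_of_tendsto (hF (tendsto_const_nhds (x := y'))) (hF hv)
    (h.mono fun i hi => hi.2 y' hy')

lemma mem_argmaxSet_zero_iff :
    y ∈ p.argmaxSet θ 0 ↔ 0 ≤ y ∧ ∀ y', 0 ≤ y' → p.F y' θ ≤ p.F y θ := by
  simp [argmaxSet]

namespace Admissible

lemma F_lt_F_benchmark_add_one (hp : p.Admissible) (hθ : 0 ≤ θ) (hy : 0 ≤ y) (hyγ : y ≤ p.γ) :
    p.F y θ < p.F (p.γ + 1) θ := by
  rw [F_of_le_benchmark hp.α_ne_zero hyγ, F_of_benchmark_le (by linarith), add_sub_cancel_left,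
    Real.one_rpow]
  linarith [mul_nonneg hp.k_nonneg (Real.rpow_nonneg (sub_nonneg.2 hyγ) p.α),
    mul_le_mul_of_nonneg_left
      (Real.rpow_le_rpow hy (by linarith : y ≤ p.γ + 1) hp.α_mem.1.le) hθ]

lemma exists_F_benchmark_lt (hp : p.Admissible) (hθ : θ ≤ 0) :
    ∃ y, 0 ≤ y ∧ p.F p.γ θ < p.F y θ := by
  have hγ := hp.γ_pos
  obtain ⟨t, ht, hlt⟩ :=
    exists_pos_mul_lt_rpow hp.α_mem.2 (-θ * (p.γ ^ p.α * (p.α / p.γ)))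
  refine ⟨p.γ + t, by positivity, ?_⟩
  have htangent : -θ * (p.γ + t) ^ p.α ≤
      -θ * p.γ ^ p.α + -θ * (p.γ ^ p.α * (p.α / p.γ)) * t :=
    calc -θ * (p.γ + t) ^ p.α ≤ -θ * (p.γ ^ p.α * (1 + p.α * (t / p.γ))) :=
          mul_le_mul_of_nonneg_left
            (add_rpow_le_rpow_mul_one_add ⟨hp.α_mem.1.le, hp.α_mem.2.le⟩ hγ ht.le) (by linarith)
      _ = _ := by ring
  rw [F_benchmark hp.α_ne_zero, F_of_benchmark_le (by linarith), add_sub_cancel_left]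
  linarith

/-- For `θ ≤ 0` the function `F(·; θ)` is convex on `[0, γ]`. -/
lemma F_le_chord (hp : p.Admissible) (hθ : θ ≤ 0) (hy : 0 ≤ y) (hyγ : y ≤ p.γ) :
    p.F y θ ≤ (1 - y / p.γ) * p.F 0 θ + y / p.γ * p.F p.γ θ := by
  have hγ := hp.γ_pos
  set w := y / p.γ with hw
  have hw0 : 0 ≤ w := by positivity
  have hw1 : w ≤ 1 := (div_le_one hγ).2 hyγ
  have hyw : y = p.γ * w := by rw [hw, mul_div_cancel₀ _ hγ.ne']
  have hrpow : y ^ p.α = p.γ ^ p.α * w ^ p.α := by rw [hyw, Real.mul_rpow hγ.le hw0]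
  have hrpow_sub : (p.γ - y) ^ p.α = p.γ ^ p.α * (1 - w) ^ p.α := by
    rw [← Real.mul_rpow hγ.le (sub_nonneg.2 hw1), mul_sub, mul_one, ← hyw]
  have hgain : -θ * p.γ ^ p.α * w ≤ -θ * p.γ ^ p.α * w ^ p.α :=
    mul_le_mul_of_nonneg_left (Real.self_le_rpow_of_le_one hw0 hw1 hp.α_mem.2.le)
      (mul_nonneg (neg_nonneg.2 hθ) (Real.rpow_nonneg hγ.le _))
  have hloss : p.k * p.γ ^ p.α * (1 - w) ≤ p.k * p.γ ^ p.α * (1 - w) ^ p.α :=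
    mul_le_mul_of_nonneg_left
      (Real.self_le_rpow_of_le_one (sub_nonneg.2 hw1) (sub_le_self 1 hw0) hp.α_mem.2.le)
      (mul_nonneg hp.k_nonneg (Real.rpow_nonneg hγ.le _))
  rw [F_zero hp.α_ne_zero hγ.le, F_benchmark hp.α_ne_zero, F_of_le_benchmark hp.α_ne_zero hyγ,
    hrpow, hrpow_sub]
  linarith

lemma benchmark_lt_of_mem_argmaxSet_zero (hp : p.Admissible) (hy : y ∈ p.argmaxSet θ 0)
    (hpos : 0 < y) : p.γ < y := by
  have hγ := hp.γ_pos
  obtain ⟨-, hmax⟩ := mem_argmaxSet_zero_iff.1 hy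
  by_contra! hle
  rcases le_or_gt 0 θ with hθ | hθ
  · linarith [hp.F_lt_F_benchmark_add_one hθ hpos.le hle, hmax (p.γ + 1) (by linarith)]
  · obtain ⟨y', hy', hgt⟩ := hp.exists_F_benchmark_lt hθ.le
    have hchord := hp.F_le_chord hθ.le hpos.le hle
    have hw0 : 0 < y / p.γ := by positivity
    have hw1 : y / p.γ ≤ 1 := (div_le_one hγ).2 hle
    have := mul_le_mul_of_nonneg_left (hmax 0 le_rfl) (sub_nonneg.2 hw1)
    have := mul_lt_mul_of_pos_left (hgt.trans_le (hmax y' hy')) hw0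
    linarith

lemma first_order_condition (hp : p.Admissible) (hy : y ∈ p.argmaxSet θ 0) (hpos : 0 < y) :
    ((y - p.γ) / y) ^ (p.α - 1) = -θ := by
  have hγy := hp.benchmark_lt_of_mem_argmaxSet_zero hy hpos
  have hderiv : HasDerivAt (fun w : ℝ => (w - p.γ) ^ p.α + θ * w ^ p.α)
      (1 * p.α * (y - p.γ) ^ (p.α - 1) + θ * (1 * p.α * y ^ (p.α - 1))) y :=
    (((hasDerivAt_id y).sub_const p.γ).rpow_const (Or.inl (sub_pos.2 hγy).ne')).add
      (((hasDerivAt_id y).rpow_const (Or.inl hpos.ne')).const_mul θ)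
  have hmax : IsLocalMax (fun w : ℝ => (w - p.γ) ^ p.α + θ * w ^ p.α) y := by
    filter_upwards [Ioi_mem_nhds hγy] with w hw
    have := (mem_argmaxSet_zero_iff.1 hy).2 w (hp.γ_pos.trans hw).le
    rwa [F_of_benchmark_le hw.le, F_of_benchmark_le hγy.le] at this
  have hzero : (y - p.γ) ^ (p.α - 1) + θ * y ^ (p.α - 1) = 0 :=
    (mul_eq_zero.1 ((by ring : p.α * _ = _).trans (hmax.hasDerivAt_eq_zero hderiv))).resolve_left
      hp.α_ne_zero
  rw [Real.div_rpow (sub_pos.2 hγy).le hpos.le,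
    div_eq_iff (Real.rpow_pos_of_pos hpos _).ne']
  linarith

lemma eq_of_mem_argmaxSet_zero_of_pos (hp : p.Admissible) (hy : y ∈ p.argmaxSet θ 0)
    (hpos : 0 < y) (hy' : y' ∈ p.argmaxSet θ 0) (hpos' : 0 < y') : y = y' := by
  have hγy := hp.benchmark_lt_of_mem_argmaxSet_zero hy hpos
  have hγy' := hp.benchmark_lt_of_mem_argmaxSet_zero hy' hpos'
  have hq : (y - p.γ) / y = (y' - p.γ) / y' :=
    Real.rpow_left_injOn (sub_ne_zero.2 hp.α_mem.2.ne)
      (div_nonneg (sub_pos.2 hγy).le hpos.le) (div_nonneg (sub_pos.2 hγy').le hpos'.le)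
      ((hp.first_order_condition hy hpos).trans (hp.first_order_condition hy' hpos').symm)
  rw [div_eq_div_iff hpos.ne' hpos'.ne'] at hq
  exact (mul_left_cancel₀ hp.γ_pos.ne' (by linarith)).symm

lemma argmaxSet_zero_subset_pair (hp : p.Admissible) (hy : y ∈ p.argmaxSet θ 0) (hpos : 0 < y) :
    p.argmaxSet θ 0 ⊆ {0, y} := fun _ hw =>
  hw.1.eq_or_lt.imp Eq.symm fun hw0 => hp.eq_of_mem_argmaxSet_zero_of_pos hw hw0 hy hpos

lemma eq_thetaLow_of_mem_argmaxSet_zero (hp : p.Admissible) (h0 : (0 : ℝ) ∈ p.argmaxSet θ 0)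
    (hy : y ∈ p.argmaxSet θ 0) (hpos : 0 < y) : θ = p.thetaLow := by
  have h1 := hp.one_sub_α_pos
  have hγ := hp.γ_pos
  have hγy := hp.benchmark_lt_of_mem_argmaxSet_zero hy hpos
  set q := (y - p.γ) / y with hq_def
  have hq : 0 < q := div_pos (sub_pos.2 hγy) hpos
  have hq' : 0 < 1 - q := by
    rw [hq_def, one_sub_div hpos.ne', sub_sub_cancel]
    positivity
  have hθ : θ = -q ^ (p.α - 1) := by rw [hp.first_order_condition hy hpos, neg_neg]
  have hvalue : p.F y θ = p.F 0 θ :=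
    le_antisymm ((mem_argmaxSet_zero_iff.1 h0).2 y hpos.le)
      ((mem_argmaxSet_zero_iff.1 hy).2 0 le_rfl)
  have hk : p.k * (1 - q) ^ p.α = q ^ (p.α - 1) * (1 - q) := by
    have hya : 0 < y ^ p.α := Real.rpow_pos_of_pos hpos _
    rw [F_of_benchmark_le hγy.le, F_zero hp.α_ne_zero hγ.le, hθ,
      show y - p.γ = y * q by rw [hq_def, mul_div_cancel₀ _ hpos.ne'],
      show p.γ = y * (1 - q) by rw [hq_def]; field_simp; ring, Real.mul_rpow hpos.le hq.le,
      Real.mul_rpow hpos.le hq'.le] at hvalue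
    refine mul_left_cancel₀ hya.ne' ?_
    rw [mul_sub, mul_one, ← Real.rpow_add_one hq.ne', sub_add_cancel]
    linarith
  have hk_eq : p.k = ((1 - q) / q) ^ (1 - p.α) := by
    rw [Real.div_rpow hq'.le hq.le, Real.rpow_sub hq', Real.rpow_one, div_right_comm,
      eq_div_iff (Real.rpow_pos_of_pos hq' _).ne', hk, div_eq_mul_inv, ← Real.rpow_neg hq.le,
      neg_sub, mul_comm]
  have hroot : 1 + p.k ^ (1 / (1 - p.α)) = q⁻¹ := by
    rw [hk_eq, one_div, Real.rpow_rpow_inv (div_nonneg hq'.le hq.le) h1.ne']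
    field_simp
    ring
  rw [thetaLow, hroot, Real.inv_rpow hq.le, ← Real.rpow_neg hq.le, neg_sub, hθ]

lemma zero_mem_and_exists_pos_of_not_subsingleton (hp : p.Admissible)
    (h : ¬(p.argmaxSet θ 0).Subsingleton) :
    (0 : ℝ) ∈ p.argmaxSet θ 0 ∧ ∃ y ∈ p.argmaxSet θ 0, 0 < y := by
  obtain ⟨y, hy, y', hy', hne⟩ := not_subsingleton_iff.1 h
  rcases hy.1.eq_or_lt with rfl | hpos
  · exact ⟨hy, y', hy', hy'.1.lt_of_ne hne⟩
  · have h0 := (hp.argmaxSet_zero_subset_pair hy hpos hy').resolve_right fun h => hne h.symm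
    exact ⟨h0 ▸ hy', y, hy, hpos⟩

lemma subsingleton_argmaxSet_zero (hp : p.Admissible) (hθ : θ ≠ p.thetaLow) :
    (p.argmaxSet θ 0).Subsingleton := by
  by_contra h
  obtain ⟨h0, y, hy, hpos⟩ := hp.zero_mem_and_exists_pos_of_not_subsingleton h
  exact hθ (hp.eq_thetaLow_of_mem_argmaxSet_zero h0 hy hpos)

lemma argmaxSel_mem (hp : p.Admissible) (θ : ℝ) (hx : 0 < x) :
    p.argmaxSel θ x ∈ p.argmaxSet θ x :=
  Classical.epsilon_spec (hp.argmaxSet_nonempty hx)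

lemma antitoneOn_argmaxSel (hp : p.Admissible) (θ : ℝ) : AntitoneOn (p.argmaxSel θ) (Ioi 0) := by
  intro u hu v hv huv
  rcases huv.eq_or_lt with rfl | h
  · exact le_rfl
  · exact le_of_mem_argmaxSet_of_lt h (hp.argmaxSel_mem θ hu) (hp.argmaxSel_mem θ hv)

lemma countable_not_continuousAt_argmaxSel (hp : p.Admissible) (θ : ℝ) :
    {x | 0 < x ∧ ¬ContinuousAt (p.argmaxSel θ) x}.Countable := by
  refine (hp.antitoneOn_argmaxSel θ).countable_not_continuousWithinAt.mono ?_
  rintro x ⟨hx, hcont⟩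
  exact ⟨hx, fun h => hcont (h.continuousAt (Ioi_mem_nhds hx))⟩

lemma argmaxSet_subset_of_continuousAt (hp : p.Admissible) (hx : 0 < x)
    (h : ContinuousAt (p.argmaxSel θ) x) : p.argmaxSet θ x ⊆ {p.argmaxSel θ x} := by
  intro y hy
  apply le_antisymm
  · refine ge_of_tendsto (h.tendsto.mono_left (nhdsWithin_le_nhds (s := Iio x))) ?_
    filter_upwards [Ioo_mem_nhdsLT hx] with u hu
    exact le_of_mem_argmaxSet_of_lt hu.2 (hp.argmaxSel_mem θ hu.1) hy
  · refine le_of_tendsto (h.tendsto.mono_left (nhdsWithin_le_nhds (s := Ioi x))) ?_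
    filter_upwards [self_mem_nhdsWithin] with u hu
    exact le_of_mem_argmaxSet_of_lt hu hy (hp.argmaxSel_mem θ (hx.trans hu))

end Admissible

lemma perturbed_slope_mono {σ ν ε ε' : ℝ} (hε : ε < ε')
    (hy : y ∈ p.argmaxSet (θ + ε * σ) (x + ε * ν))
    (hy' : y' ∈ p.argmaxSet (θ + ε' * σ) (x + ε' * ν)) :
    σ * y ^ p.α - ν * y ≤ σ * y' ^ p.α - ν * y' := by
  have h1 := hy.2 y' hy'.1
  have h2 := hy'.2 y hy.1
  simp only [F_add] at h1 h2
  nlinarith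

lemma tendsto_perturbed_slope (hp : p.Admissible) {σ ν W : ℝ} {v : ℝ → ℝ} (hν : 0 < ν)
    (hW : IsGreatest ((fun y => σ * y ^ p.α - ν * y) '' p.argmaxSet θ x) W)
    (hv : ∀ ε > 0, v ε ∈ p.argmaxSet (θ + ε * σ) (x + ε * ν)) :
    Tendsto (fun ε => σ * v ε ^ p.α - ν * v ε) (𝓝[>] 0) (𝓝 W) := by
  set slope : ℝ → ℝ := fun y => σ * y ^ p.α - ν * y
  have hslope : Continuous slope :=
    (continuous_const.mul (Real.continuous_rpow_const hp.α_mem.1.le)).sub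
      (continuous_const.mul continuous_id)
  have hW_le : ∀ ε > 0, W ≤ slope (v ε) := by
    obtain ⟨y, hy, rfl⟩ := hW.1
    exact fun ε hε => perturbed_slope_mono hε (by simpa using hy) (hv ε hε)
  obtain ⟨b, hb⟩ := bddAbove_setOf_le_mul_rpow_sub_mul hp.α_mem.2 σ hν W
  have hv_mem : ∀ᶠ ε in 𝓝[>] (0 : ℝ), v ε ∈ Icc 0 b := by
    filter_upwards [self_mem_nhdsWithin] with ε hε
    exact ⟨(hv ε hε).1, hb ⟨(hv ε hε).1, hW_le ε hε⟩⟩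
  refine (isCompact_Icc.image hslope).tendsto_nhds_of_unique_mapClusterPt
    (hv_mem.mono fun ε hε => mem_image_of_mem slope hε) fun c _ hc => ?_
  obtain ⟨V, hV, hVc⟩ := mapClusterPt_iff_ultrafilter.1 hc
  obtain ⟨w, -, hw⟩ := isCompact_Icc.ultrafilter_le_nhds (V.map v) (le_principal_iff.2 (hV hv_mem))
  have hlin : ∀ s t : ℝ, Tendsto (fun ε : ℝ => s + ε * t) V (𝓝 s) := fun s t =>
    Tendsto.mono_left (Continuous.tendsto' (by fun_prop) 0 s (by simp))
      (hV.trans nhdsWithin_le_nhds)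
  have hw_mem : w ∈ p.argmaxSet θ x :=
    mem_argmaxSet_of_tendsto hp.α_mem.1 (hlin θ σ) (hlin x ν) hw
      (hV (mem_of_superset self_mem_nhdsWithin hv))
  have hcw : slope w = c := tendsto_nhds_unique ((hslope.tendsto w).comp hw) hVc
  refine le_antisymm (hcw ▸ hW.2 (mem_image_of_mem slope hw_mem)) ?_
  exact ge_of_tendsto hVc (hV (mem_of_superset self_mem_nhdsWithin hW_le))

lemma thetaLow_neg (hk : 0 ≤ p.k) : p.thetaLow < 0 :=
  neg_neg_of_pos (Real.rpow_pos_of_pos (by positivity) _)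

lemma disc_pos (p : Params) : 0 < p.disc := Real.exp_pos _

lemma disc_mul_exp_lt_one (hτ : 0 < p.τ) (h : p.h < p.δ) :
    p.disc * Real.exp (p.h * p.τ) < 1 := by
  rw [disc, ← Real.exp_add, Real.exp_lt_one_iff, ← add_mul]
  exact mul_neg_of_neg_of_pos (by linarith) hτ

section Kappa

variable {ξ ξ' : ℝ}

lemma disc_mul_lt_one (hde : p.disc * Real.exp (p.h * p.τ) < 1) (hξ : ξ ≤ Real.exp (p.h * p.τ)) :
    p.disc * ξ < 1 :=
  (mul_le_mul_of_nonneg_left hξ p.disc_pos.le).trans_lt hde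

lemma le_kappa_denom (hβ : p.β ≤ 1) (hξ : p.disc * ξ ≤ 1) :
    p.β ≤ 1 - (1 - p.β) * p.disc * ξ := by
  nlinarith

lemma kappa_denom_pos (hβ : p.β ∈ Icc (0 : ℝ) 1) (hξ : p.disc * ξ < 1) :
    0 < 1 - (1 - p.β) * p.disc * ξ := by
  rcases hβ.1.eq_or_lt with h0 | h0
  · simpa [← h0] using hξ
  · exact h0.trans_le (le_kappa_denom hβ.2 hξ.le)

lemma kappa_mem_Icc (hβ : p.β ∈ Icc (0 : ℝ) 1) (hξ : p.disc * ξ < 1) :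
    p.kappa ξ ∈ Icc (0 : ℝ) 1 :=
  ⟨div_nonneg hβ.1 (kappa_denom_pos hβ hξ).le,
    (div_le_one (kappa_denom_pos hβ hξ)).2 (le_kappa_denom hβ.2 hξ.le)⟩

lemma continuousOn_kappa (hβ : p.β ∈ Icc (0 : ℝ) 1) :
    ContinuousOn p.kappa {ξ | p.disc * ξ < 1} :=
  continuousOn_const.div (by fun_prop) fun _ hξ => (kappa_denom_pos hβ hξ).ne'

lemma kappa_lt_kappa (hβ : p.β ∈ Ioo (0 : ℝ) 1) (hξ' : p.disc * ξ' < 1) (hlt : ξ < ξ') :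
    p.kappa ξ < p.kappa ξ' := by
  have hslope : 0 < (1 - p.β) * p.disc := mul_pos (sub_pos.2 hβ.2) p.disc_pos
  refine div_lt_div_of_pos_left hβ.1 (kappa_denom_pos (Ioo_subset_Icc_self hβ) hξ') ?_
  linarith [mul_lt_mul_of_pos_left hlt hslope]

end Kappa

end Params

lemma kernelZ_pos {Ω : Type*} (B : ℝ≥0 → Ω → ℝ) (p : Params) (t : ℝ≥0) (ω : Ω) :
    0 < kernelZ B p t ω :=
  Real.exp_pos _

lemma kernelZ_rpow {Ω : Type*} (B : ℝ≥0 → Ω → ℝ) (p : Params) (t : ℝ≥0) (c : ℝ)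
    (ω : Ω) :
    kernelZ B p t ω ^ c =
      Real.exp (-(c * p.φ) * B t ω) * Real.exp (-(c * (p.r + p.φ ^ 2 / 2) * t)) := by
  rw [kernelZ, ← Real.exp_mul, ← Real.exp_add]
  ring_nf

section Kernel

variable {Ω : Type*} [mΩ : MeasurableSpace Ω] {P : Measure Ω} {B : ℝ≥0 → Ω → ℝ} {p : Params}
  {t : ℝ≥0}

lemma measurable_kernelZ_augmented (P : Measure Ω) (B : ℝ≥0 → Ω → ℝ) (p : Params) (t : ℝ≥0) :
    Measurable[augmented B P t] (kernelZ B p t) := by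
  have hle : MeasurableSpace.comap (B t) inferInstance ≤ augmented B P t :=
    le_sup_of_le_left (le_iSup₂_of_le t self_mem_Iic le_rfl)
  have hB : Measurable[augmented B P t] (B t) := (comap_measurable (B t)).mono hle le_rfl
  unfold kernelZ
  fun_prop

lemma aemeasurable_of_measurable_augmented (hB : ∀ s ≤ t, AEMeasurable (B s) P) {Y : Ω → ℝ}
    (hY : Measurable[augmented B P t] Y) : AEMeasurable Y P := by
  have hle : augmented B P t ≤
      (inferInstance : MeasurableSpace (NullMeasurableSpace Ω P)) := by
    refine sup_le (iSup₂_le fun s hs => ?_) (MeasurableSpace.generateFrom_le fun N hN => ?_)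
    · exact Measurable.comap_le (hB s hs).nullMeasurable
    · exact NullMeasurableSet.of_null hN
  exact NullMeasurable.aemeasurable fun s hs => hle _ (hY hs)

lemma integrable_kernelZ_rpow (hB : HasLaw (B t) (gaussianReal 0 t) P) (c : ℝ) :
    Integrable (fun ω => kernelZ B p t ω ^ c) P := by
  have hexp := integrable_exp_mul_gaussianReal (μ := 0) (v := t) (-(c * p.φ))
  rw [← hB.map_eq] at hexp
  simp only [kernelZ_rpow]
  exact (hexp.comp_aemeasurable hB.aemeasurable).mul_const _

lemma integral_kernelZ_rpow (hB : HasLaw (B t) (gaussianReal 0 t) P) (c : ℝ) :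
    ∫ ω, kernelZ B p t ω ^ c ∂P =
      Real.exp (((c * p.φ) ^ 2 / 2 - c * (p.r + p.φ ^ 2 / 2)) * t) := by
  have hmgf : ∫ ω, Real.exp (-(c * p.φ) * B t ω) ∂P =
      Real.exp (0 * -(c * p.φ) + t * (-(c * p.φ)) ^ 2 / 2) :=
    mgf_gaussianReal hB.map_eq _
  simp only [kernelZ_rpow]
  rw [integral_mul_const, hmgf, ← Real.exp_add]
  ring_nf

lemma measure_kernelZ_eq (hB : HasLaw (B t) (gaussianReal 0 t) P) (hφ : p.φ ≠ 0) (ht : t ≠ 0)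
    (c : ℝ) : P {ω | kernelZ B p t ω = c} = 0 := by
  have hsub : {x : ℝ | Real.exp (-p.φ * x - (p.r + p.φ ^ 2 / 2) * t) = c}.Subsingleton :=
    fun x hx y hy => mul_left_cancel₀ (neg_ne_zero.2 hφ)
      (sub_left_injective (Real.exp_injective (hx.trans hy.symm)))
  have := nullSingletonClass_gaussianReal (μ := 0) ht
  have hnull := hsub.measure_zero (gaussianReal 0 t)
  rwa [← hB.map_eq, Measure.map_apply_of_aemeasurable hB.aemeasurable hsub.measurableSet] at hnull

/-- The properties of the preferences and of the pricing kernel on which the portfolio problem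
depends. -/
structure RegularKernel (P : Measure Ω) (B : ℝ≥0 → Ω → ℝ) (p : Params) : Prop
    extends p.Admissible where
  aemeasurable : ∀ {Y : Ω → ℝ}, Measurable[augmented B P p.τ] Y → AEMeasurable Y P
  integrable_kernel : Integrable (kernelZ B p p.τ) P
  integrable_kernel_rpow : Integrable (fun ω => kernelZ B p p.τ ω ^ (-(p.α / (1 - p.α)))) P
  integral_kernel_rpow : ∫ ω, kernelZ B p p.τ ω ^ (-(p.α / (1 - p.α))) ∂P =
    Real.exp (p.h * p.τ) ^ (1 / (1 - p.α))
  measure_kernel_eq : ∀ c, P {ω | kernelZ B p p.τ ω = c} = 0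

lemma Params.Admissible.regularKernel (hp : p.Admissible)
    (hB : ∀ s ≤ p.τ, AEMeasurable (B s) P) (hlaw : HasLaw (B p.τ) (gaussianReal 0 p.τ) P)
    (hφ : p.φ ≠ 0) (hτ : p.τ ≠ 0) : RegularKernel P B p where
  toAdmissible := hp
  aemeasurable := aemeasurable_of_measurable_augmented hB
  integrable_kernel := by simpa using integrable_kernelZ_rpow (p := p) hlaw 1
  integrable_kernel_rpow := integrable_kernelZ_rpow hlaw _
  integral_kernel_rpow := by
    have := hp.one_sub_α_pos
    rw [integral_kernelZ_rpow hlaw, ← Real.exp_mul, Params.h]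
    congr 1
    field_simp
    ring
  measure_kernel_eq := measure_kernelZ_eq hlaw hφ hτ

end Kernel

section Claims

variable {Ω : Type*} [mΩ : MeasurableSpace Ω] (P : Measure Ω) (B : ℝ≥0 → Ω → ℝ) (p : Params)

local notation "Z" => kernelZ B p p.τ

/-- The nonnegative `ℱ_τ`-measurable payoffs with finite price: `returns` without the budget
constraint. -/
def claims : Set (Ω → ℝ) :=
  {Y | Measurable[augmented B P p.τ] Y ∧ (∀ ω, 0 ≤ Y ω) ∧ Integrable (fun ω => Z ω * Y ω) P}

/-- The price `E[Z_τ Y]` of a payoff `Y`. -/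
def price (Y : Ω → ℝ) : ℝ := ∫ ω, Z ω * Y ω ∂P

/-- The pointwise maximizer of the Lagrangian `F(y; θ) - l Z_τ y`, for a multiplier `l > 0`. -/
def policy (θ l : ℝ) (ω : Ω) : ℝ := p.argmaxSel θ (l * Z ω)

variable {P B p} {Y Y' : Ω → ℝ} {θ l : ℝ}

lemma mem_returns_iff : Y ∈ returns P B p ↔ Y ∈ claims P B p ∧ price P B p Y ≤ 1 := by
  simp only [returns, claims, price, mem_ofPred_eq, and_assoc]

namespace RegularKernel

lemma aemeasurable_kernel (M : RegularKernel P B p) : AEMeasurable Z P :=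
  M.aemeasurable (measurable_kernelZ_augmented P B p p.τ)

lemma nullMeasurableSet_kernel_le (M : RegularKernel P B p) (c : ℝ) :
    NullMeasurableSet {ω | Z ω ≤ c} P :=
  M.aemeasurable_kernel.nullMeasurableSet_preimage measurableSet_Iic

lemma aestronglyMeasurable_rpow (M : RegularKernel P B p) (hY : Y ∈ claims P B p) :
    AEStronglyMeasurable (fun ω => Y ω ^ p.α) P :=
  ((M.aemeasurable hY.1).pow_const p.α).aestronglyMeasurable

lemma rpow_le (M : RegularKernel P B p) (hY : Y ∈ claims P B p) (ω : Ω) :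
    Y ω ^ p.α ≤ Real.exp (p.h * p.τ) * (p.α * (Z ω * Y ω) + (1 - p.α) *
      (Z ω ^ (-(p.α / (1 - p.α))) / Real.exp (p.h * p.τ) ^ (1 / (1 - p.α)))) :=
  rpow_le_mul_weighted_mean (Ioo_subset_Ico_self M.α_mem) (hY.2.1 ω) (kernelZ_pos _ _ _ _)
    (Real.exp_pos _)

lemma integrable_rpow (M : RegularKernel P B p) (hY : Y ∈ claims P B p) :
    Integrable (fun ω => Y ω ^ p.α) P := by
  have hprice := hY.2.2.const_mul p.α
  have hkernel := (M.integrable_kernel_rpow.div_const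
    (Real.exp (p.h * p.τ) ^ (1 / (1 - p.α)))).const_mul (1 - p.α)
  exact ((hprice.add hkernel).const_mul (Real.exp (p.h * p.τ))).mono'
    (M.aestronglyMeasurable_rpow hY) (ae_of_all _ fun ω =>
      (Real.norm_of_nonneg (Real.rpow_nonneg (hY.2.1 ω) _)).trans_le (M.rpow_le hY ω))

lemma integral_rpow_le (M : RegularKernel P B p) (hY : Y ∈ claims P B p) :
    ∫ ω, Y ω ^ p.α ∂P ≤ Real.exp (p.h * p.τ) * (p.α * price P B p Y + (1 - p.α)) := by
  have hprice := hY.2.2.const_mul p.α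
  have hkernel := (M.integrable_kernel_rpow.div_const
    (Real.exp (p.h * p.τ) ^ (1 / (1 - p.α)))).const_mul (1 - p.α)
  refine (integral_mono (M.integrable_rpow hY) ((hprice.add hkernel).const_mul _)
    (M.rpow_le hY)).trans_eq ?_
  rw [integral_const_mul, integral_add' hprice hkernel, integral_const_mul, integral_const_mul,
    integral_div, M.integral_kernel_rpow, div_self (by positivity), mul_one, price]

lemma integral_rpow_mem_Icc (M : RegularKernel P B p) (hY : Y ∈ returns P B p) :
    ∫ ω, Y ω ^ p.α ∂P ∈ Icc 0 (Real.exp (p.h * p.τ)) := by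
  obtain ⟨hclaim, hbudget⟩ := mem_returns_iff.1 hY
  refine ⟨integral_nonneg fun ω => Real.rpow_nonneg (hclaim.2.1 ω) _, ?_⟩
  refine (M.integral_rpow_le hclaim).trans (mul_le_of_le_one_right (Real.exp_pos _).le ?_)
  linarith [mul_le_of_le_one_right M.α_mem.1.le hbudget]

lemma integrable_F [IsFiniteMeasure P] (M : RegularKernel P B p) (hY : Y ∈ claims P B p)
    (θ : ℝ) : Integrable (fun ω => p.F (Y ω) θ) P := by
  have hmeas := ((Params.continuous_U M.α_mem.1).measurable.comp_aemeasurable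
    ((M.aemeasurable hY.1).sub_const p.γ)).aestronglyMeasurable
  have hU : Integrable (fun ω => p.U (Y ω - p.γ)) P :=
    ((integrable_const (p.k * p.γ ^ p.α)).add (M.integrable_rpow hY)).mono' hmeas
      (ae_of_all _ fun ω => M.abs_U_sub_benchmark_le (hY.2.1 ω))
  exact hU.add ((M.integrable_rpow hY).const_mul θ)

lemma integral_F_add [IsFiniteMeasure P] (M : RegularKernel P B p) (hY : Y ∈ claims P B p)
    (θ c : ℝ) :
    ∫ ω, p.F (Y ω) (θ + c) ∂P = ∫ ω, p.F (Y ω) θ ∂P + c * ∫ ω, Y ω ^ p.α ∂P := by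
  simp_rw [Params.F_add]
  rw [integral_add (M.integrable_F hY θ) ((M.integrable_rpow hY).const_mul c), integral_const_mul]

lemma integral_F_sub_mul_price_le [IsFiniteMeasure P] (M : RegularKernel P B p)
    (hY : Y ∈ claims P B p) (hY' : Y' ∈ claims P B p)
    (hmax : ∀ ω, Y' ω ∈ p.argmaxSet θ (l * Z ω)) :
    ∫ ω, p.F (Y ω) θ ∂P - l * price P B p Y ≤ ∫ ω, p.F (Y' ω) θ ∂P - l * price P B p Y' := by
  have hmono := integral_mono ((M.integrable_F hY θ).sub (hY.2.2.const_mul l))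
    ((M.integrable_F hY' θ).sub (hY'.2.2.const_mul l)) fun ω => by
      simpa only [Pi.sub_apply, mul_assoc] using (hmax ω).2 (Y ω) (hY.2.1 ω)
  simp only [Pi.sub_apply] at hmono
  rwa [integral_sub (M.integrable_F hY θ) (hY.2.2.const_mul l),
    integral_sub (M.integrable_F hY' θ) (hY'.2.2.const_mul l), integral_const_mul,
    integral_const_mul] at hmono

lemma policy_mem (M : RegularKernel P B p) (θ : ℝ) (hl : 0 < l) (ω : Ω) :
    policy B p θ l ω ∈ p.argmaxSet θ (l * Z ω) :=
  M.argmaxSel_mem θ (mul_pos hl (kernelZ_pos _ _ _ _))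

lemma measurable_policy (M : RegularKernel P B p) (θ : ℝ) (hl : 0 < l) :
    Measurable[augmented B P p.τ] (policy B p θ l) := by
  have hanti : Antitone fun u => p.argmaxSel θ (Real.exp u) := fun u v huv =>
    M.antitoneOn_argmaxSel θ (Real.exp_pos u) (Real.exp_pos v) (Real.exp_le_exp.2 huv)
  have hlog : Measurable[augmented B P p.τ] fun ω => Real.log (l * Z ω) :=
    (Real.measurable_log.comp (measurable_const_mul l)).comp
      (measurable_kernelZ_augmented P B p p.τ)
  have hcomp : policy B p θ l =
      (fun u => p.argmaxSel θ (Real.exp u)) ∘ fun ω => Real.log (l * Z ω) := funext fun ω => by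
    simp only [policy, Function.comp_apply, Real.exp_log (mul_pos hl (kernelZ_pos _ _ _ _))]
  rw [hcomp]
  exact hanti.measurable.comp hlog

lemma kernel_mul_policy_le (M : RegularKernel P B p) (θ : ℝ) (hl : 0 < l) (ω : Ω) :
    Z ω * policy B p θ l ω ≤
      ((1 + p.k + |θ|) / l) ^ (1 / (1 - p.α)) * Z ω ^ (-(p.α / (1 - p.α))) := by
  have hz := kernelZ_pos B p p.τ ω
  have hα := M.one_sub_α_pos
  have hk := M.k_nonneg
  calc Z ω * policy B p θ l ω
      ≤ Z ω * ((1 + p.k + |θ|) / (l * Z ω)) ^ (1 / (1 - p.α)) :=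
        mul_le_mul_of_nonneg_left
          (M.le_of_mem_argmaxSet (mul_pos hl hz) (M.policy_mem θ hl ω)) hz.le
    _ = ((1 + p.k + |θ|) / l) ^ (1 / (1 - p.α)) * Z ω ^ (1 + -(1 / (1 - p.α))) := by
        rw [← div_div, Real.div_rpow (by positivity) hz.le, Real.rpow_add hz, Real.rpow_one,
          Real.rpow_neg hz.le]
        ring
    _ = _ := by
        congr 2
        field_simp
        ring

lemma policy_mem_claims (M : RegularKernel P B p) (θ : ℝ) (hl : 0 < l) :
    policy B p θ l ∈ claims P B p := by
  refine ⟨M.measurable_policy θ hl, fun ω => (M.policy_mem θ hl ω).1, ?_⟩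
  have hmeas := M.aemeasurable_kernel.mul (M.aemeasurable (M.measurable_policy θ hl))
  exact (M.integrable_kernel_rpow.const_mul (((1 + p.k + |θ|) / l) ^ (1 / (1 - p.α)))).mono'
    hmeas.aestronglyMeasurable (ae_of_all _ fun ω =>
      (Real.norm_of_nonneg (mul_nonneg (kernelZ_pos _ _ _ _).le
        (M.policy_mem θ hl ω).1)).trans_le (M.kernel_mul_policy_le θ hl ω))

lemma ae_continuousAt_argmaxSel (M : RegularKernel P B p) (θ : ℝ) (hl : 0 < l) :
    ∀ᵐ ω ∂P, ContinuousAt (p.argmaxSel θ) (l * Z ω) := by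
  have hne : ∀ᵐ ω ∂P, ∀ x ∈ {x | 0 < x ∧ ¬ContinuousAt (p.argmaxSel θ) x}, l * Z ω ≠ x := by
    refine (ae_ball_iff (M.countable_not_continuousAt_argmaxSel θ)).2 fun x _ => ?_
    refine measure_mono_null (fun ω hω => ?_) (M.measure_kernel_eq (x / l))
    exact eq_div_of_mul_eq hl.ne' ((mul_comm _ _).trans (not_not.1 hω))
  filter_upwards [hne] with ω hω
  by_contra hcont
  exact hω _ ⟨mul_pos hl (kernelZ_pos _ _ _ _), hcont⟩ rfl

lemma const_mem_returns (M : RegularKernel P B p) {y : ℝ} (hy : 0 ≤ y)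
    (h : y * ∫ ω, Z ω ∂P ≤ 1) : (fun _ => y) ∈ returns P B p := by
  refine ⟨measurable_const, fun _ => hy, M.integrable_kernel.mul_const y, ?_⟩
  rwa [integral_mul_const, mul_comm]

lemma Phi_le (M : RegularKernel P B p) {c : ℝ}
    (h : ∀ Y ∈ returns P B p, ∫ ω, p.F (Y ω) θ ∂P ≤ c) : Phi P B p θ ≤ c :=
  csSup_le (Nonempty.image _ ⟨_, M.const_mem_returns le_rfl (by simp)⟩) (forall_mem_image.2 h)

end RegularKernel

end Claims

section Phi

variable {Ω : Type*} [mΩ : MeasurableSpace Ω] {P : Measure Ω} [IsProbabilityMeasure P]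
  {B : ℝ≥0 → Ω → ℝ} {p : Params} {Y : Ω → ℝ} {θ θ' l : ℝ}

namespace RegularKernel

lemma bddAbove_integral_F (M : RegularKernel P B p) (θ : ℝ) :
    BddAbove ((fun Y : Ω → ℝ => ∫ ω, p.F (Y ω) θ ∂P) '' returns P B p) := by
  have hk := M.k_nonneg
  refine ⟨p.F 0 θ + (1 + p.k + |θ|) * Real.exp (p.h * p.τ), forall_mem_image.2 fun Y hY => ?_⟩
  obtain ⟨hclaim, -⟩ := mem_returns_iff.1 hY
  have hpow := (M.integrable_rpow hclaim).const_mul (1 + p.k + |θ|)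
  calc ∫ ω, p.F (Y ω) θ ∂P
      ≤ ∫ ω, (p.F 0 θ + (1 + p.k + |θ|) * Y ω ^ p.α) ∂P :=
        integral_mono (M.integrable_F hclaim θ) ((integrable_const _).add hpow)
          fun ω => M.F_le θ (hclaim.2.1 ω)
    _ = p.F 0 θ + (1 + p.k + |θ|) * ∫ ω, Y ω ^ p.α ∂P := by
        rw [integral_add (integrable_const _) hpow, integral_const_mul, integral_const,
          probReal_univ, one_smul]
    _ ≤ _ := by
        gcongr
        exact (M.integral_rpow_mem_Icc hY).2

lemma le_Phi (M : RegularKernel P B p) (hY : Y ∈ returns P B p) (θ : ℝ) :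
    ∫ ω, p.F (Y ω) θ ∂P ≤ Phi P B p θ :=
  le_csSup (M.bddAbove_integral_F θ) (mem_image_of_mem _ hY)

lemma integral_F_eq_add_mul (M : RegularKernel P B p) (hY : Y ∈ claims P B p) (θ θ' : ℝ) :
    ∫ ω, p.F (Y ω) θ' ∂P = ∫ ω, p.F (Y ω) θ ∂P + (θ' - θ) * ∫ ω, Y ω ^ p.α ∂P := by
  rw [← M.integral_F_add hY, add_sub_cancel]

lemma monotone_Phi (M : RegularKernel P B p) : Monotone (Phi P B p) := fun θ θ' h =>
  M.Phi_le fun Y hY => by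
    have := mul_nonneg (sub_nonneg.2 h) (M.integral_rpow_mem_Icc hY).1
    linarith [M.le_Phi hY θ', M.integral_F_eq_add_mul (mem_returns_iff.1 hY).1 θ θ']

lemma Phi_le_add (M : RegularKernel P B p) (h : θ ≤ θ') :
    Phi P B p θ' ≤ Phi P B p θ + Real.exp (p.h * p.τ) * (θ' - θ) :=
  M.Phi_le fun Y hY => by
    have := mul_le_mul_of_nonneg_left (M.integral_rpow_mem_Icc hY).2 (sub_nonneg.2 h)
    linarith [M.le_Phi hY θ, M.integral_F_eq_add_mul (mem_returns_iff.1 hY).1 θ θ']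

lemma lipschitzWith_Phi (M : RegularKernel P B p) :
    LipschitzWith (Real.exp (p.h * p.τ)).toNNReal (Phi P B p) := by
  refine LipschitzWith.of_le_add_mul' _ fun θ' θ => ?_
  rcases le_total θ θ' with h | h
  · rw [Real.dist_eq, abs_of_nonneg (sub_nonneg.2 h)]
    exact M.Phi_le_add h
  · exact (M.monotone_Phi h).trans (le_add_of_nonneg_right (by positivity))

lemma subdifferential_Phi_subset_Icc (M : RegularKernel P B p) (θ : ℝ) :
    subdifferential (Phi P B p) θ ⊆ Icc 0 (Real.exp (p.h * p.τ)) :=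
  subdifferential_subset_Icc M.monotone_Phi (fun _ _ h => M.Phi_le_add h) θ

lemma optimalMoments_subset_subdifferential (M : RegularKernel P B p) (θ : ℝ) :
    optimalMoments P B p (fun y => p.F y θ) ⊆ subdifferential (Phi P B p) θ := by
  refine image_subset_iff.2 fun Y hY θ' => ?_
  have hattained : Phi P B p θ ≤ ∫ ω, p.F (Y ω) θ ∂P := M.Phi_le hY.2
  linarith [M.le_Phi hY.1 θ', M.integral_F_eq_add_mul (mem_returns_iff.1 hY.1).1 θ θ']

lemma Phi_le_dual (M : RegularKernel P B p) (hl : 0 ≤ l) (hY : Y ∈ claims P B p)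
    (hmax : ∀ ω, Y ω ∈ p.argmaxSet θ (l * kernelZ B p p.τ ω)) :
    Phi P B p θ ≤ ∫ ω, p.F (Y ω) θ ∂P + l * (1 - price P B p Y) :=
  M.Phi_le fun Y' hY' => by
    obtain ⟨hclaim, hbudget⟩ := mem_returns_iff.1 hY'
    linarith [M.integral_F_sub_mul_price_le hclaim hY hmax, mul_le_mul_of_nonneg_left hbudget hl]

end RegularKernel

end Phi

section KKT

variable {Ω : Type*} [mΩ : MeasurableSpace Ω]

/-- The Karush-Kuhn-Tucker conditions for `sup {E[F(Y; θ)] : Y ∈ returns}`: the payoff `Y` maximizes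
the Lagrangian with multiplier `l` in every state, and its budget binds unless `l = 0`. -/
structure IsKKT (P : Measure Ω) (B : ℝ≥0 → Ω → ℝ) (p : Params) (θ l : ℝ) (Y : Ω → ℝ) :
    Prop where
  multiplier_nonneg : 0 ≤ l
  mem_returns : Y ∈ returns P B p
  mem_argmaxSet : ∀ ω, Y ω ∈ p.argmaxSet θ (l * kernelZ B p p.τ ω)
  complementary : l * (1 - price P B p Y) = 0

variable {P : Measure Ω} {B : ℝ≥0 → Ω → ℝ} {p : Params}
  {Y Y' : Ω → ℝ} {θ θ' l l' s : ℝ}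

local notation "Z" => kernelZ B p p.τ

lemma IsKKT.of_multiplier_zero (hY : Y ∈ returns P B p) (hmax : ∀ ω, Y ω ∈ p.argmaxSet θ 0) :
    IsKKT P B p θ 0 Y where
  multiplier_nonneg := le_rfl
  mem_returns := hY
  mem_argmaxSet := fun ω => by simpa only [zero_mul] using hmax ω
  complementary := zero_mul _

namespace RegularKernel

lemma integrable_slope (M : RegularKernel P B p) (hY : Y ∈ claims P B p) (σ η : ℝ) :
    Integrable (fun ω => σ * Y ω ^ p.α - η * Z ω * Y ω) P := by
  simp only [mul_assoc η]
  exact ((M.integrable_rpow hY).const_mul σ).sub (hY.2.2.const_mul η)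

lemma integral_slope (M : RegularKernel P B p) (hY : Y ∈ claims P B p) (σ η : ℝ) :
    ∫ ω, (σ * Y ω ^ p.α - η * Z ω * Y ω) ∂P =
      σ * ∫ ω, Y ω ^ p.α ∂P - η * price P B p Y := by
  simp only [mul_assoc η]
  rw [integral_sub ((M.integrable_rpow hY).const_mul σ) (hY.2.2.const_mul η),
    integral_const_mul, integral_const_mul, price]

lemma policy_anti (M : RegularKernel P B p) (θ : ℝ) (hl : 0 < l) (h : l ≤ l') (ω : Ω) :
    policy B p θ l' ω ≤ policy B p θ l ω := by
  have hz := kernelZ_pos B p p.τ ω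
  exact M.antitoneOn_argmaxSel θ (mul_pos hl hz) (mul_pos (hl.trans_le h) hz)
    (mul_le_mul_of_nonneg_right h hz.le)

lemma continuousOn_price_policy (M : RegularKernel P B p) (θ : ℝ) :
    ContinuousOn (fun l => price P B p (policy B p θ l)) (Ioi 0) := fun l (hl : 0 < l) => by
  refine ContinuousAt.continuousWithinAt (continuousAt_of_dominated
    (bound := fun ω => Z ω * policy B p θ (l / 2) ω) ?_ ?_
    (M.policy_mem_claims θ (half_pos hl)).2.2 ?_)
  · filter_upwards [Ioi_mem_nhds hl] with u hu
    exact (M.policy_mem_claims θ hu).2.2.aestronglyMeasurable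
  · filter_upwards [Ioi_mem_nhds (half_lt_self hl)] with u hu
    refine ae_of_all _ fun ω => ?_
    have hu0 : 0 < u := (half_pos hl).trans hu
    have hz := (kernelZ_pos B p p.τ ω).le
    rw [Real.norm_of_nonneg (mul_nonneg hz (M.policy_mem θ hu0 ω).1)]
    exact mul_le_mul_of_nonneg_left (M.policy_anti θ (half_pos hl) (le_of_lt hu) ω) hz
  · filter_upwards [M.ae_continuousAt_argmaxSel θ hl] with ω hω
    exact continuousAt_const.mul
      (ContinuousAt.comp (f := fun u => u * Z ω) hω (continuousAt_id.mul continuousAt_const))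

lemma exists_price_policy_le_one (M : RegularKernel P B p) (θ : ℝ) :
    ∃ l > 0, price P B p (policy B p θ l) ≤ 1 := by
  have hexp := Real.exp_pos (p.h * p.τ)
  have hc : 0 < 1 + p.k + |θ| := by
    have := M.k_nonneg
    positivity
  have hl : 0 < (1 + p.k + |θ|) * Real.exp (p.h * p.τ) := mul_pos hc hexp
  refine ⟨_, hl, (integral_mono (M.policy_mem_claims θ hl).2.2
    (M.integrable_kernel_rpow.const_mul _) (M.kernel_mul_policy_le θ hl)).trans_eq ?_⟩
  rw [integral_const_mul, M.integral_kernel_rpow, div_mul_cancel_left₀ hc.ne',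
    Real.inv_rpow hexp.le, inv_mul_cancel₀ (Real.rpow_pos_of_pos hexp _).ne']

lemma argmaxSel_mul_setIntegral_le (M : RegularKernel P B p) (θ : ℝ) {x c : ℝ} (hx : 0 < x)
    (hc : 0 < c) :
    p.argmaxSel θ x * ∫ ω in {ω | Z ω ≤ c}, Z ω ∂P ≤ price P B p (policy B p θ (x / c)) := by
  have hl : 0 < x / c := div_pos hx hc
  have hclaim := M.policy_mem_claims θ hl
  have hnonneg : 0 ≤ fun ω => Z ω * policy B p θ (x / c) ω := fun ω =>
    mul_nonneg (kernelZ_pos _ _ _ _).le (hclaim.2.1 ω)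
  calc p.argmaxSel θ x * ∫ ω in {ω | Z ω ≤ c}, Z ω ∂P
      = ∫ ω in {ω | Z ω ≤ c}, Z ω * p.argmaxSel θ x ∂P := by
        rw [integral_mul_const, mul_comm]
    _ ≤ ∫ ω in {ω | Z ω ≤ c}, Z ω * policy B p θ (x / c) ω ∂P := by
        refine integral_mono_ae (M.integrable_kernel.mul_const _).integrableOn
          hclaim.2.2.integrableOn ((ae_restrict_iff'₀
          (M.nullMeasurableSet_kernel_le c)).2 (ae_of_all _ fun ω hω => ?_))
        have hz := kernelZ_pos B p p.τ ω
        refine mul_le_mul_of_nonneg_left ?_ hz.le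
        refine M.antitoneOn_argmaxSel θ (mul_pos hl hz) hx ?_
        rw [div_mul_eq_mul_div, div_le_iff₀ hc]
        exact mul_le_mul_of_nonneg_left hω hx.le
    _ ≤ price P B p (policy B p θ (x / c)) :=
        setIntegral_le_integral hclaim.2.2 (ae_of_all _ hnonneg)

lemma mul_integral_kernel_le (M : RegularKernel P B p) {y b : ℝ}
    (h : ∀ c > 0, y * ∫ ω in {ω | Z ω ≤ c}, Z ω ∂P ≤ b) : y * ∫ ω, Z ω ∂P ≤ b :=
  le_of_tendsto ((tendsto_setIntegral_setOf_le_atTop M.aemeasurable_kernel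
    M.integrable_kernel).const_mul y) ((eventually_gt_atTop 0).mono h)

lemma isKKT_policy (M : RegularKernel P B p) (hl : 0 < l)
    (hprice : price P B p (policy B p θ l) = 1) : IsKKT P B p θ l (policy B p θ l) where
  multiplier_nonneg := hl.le
  mem_returns := mem_returns_iff.2 ⟨M.policy_mem_claims θ hl, hprice.le⟩
  mem_argmaxSet := M.policy_mem θ hl
  complementary := by rw [hprice, sub_self, mul_zero]

variable [IsProbabilityMeasure P]

lemma mem_optimizers_of_isKKT (M : RegularKernel P B p) (h : IsKKT P B p θ l Y) :
    Y ∈ optimizers P B p fun y => p.F y θ := by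
  have hdual := M.Phi_le_dual h.multiplier_nonneg (mem_returns_iff.1 h.mem_returns).1
    h.mem_argmaxSet
  rw [h.complementary, add_zero] at hdual
  exact ⟨h.mem_returns, fun Y' hY' => (M.le_Phi hY' θ).trans hdual⟩

lemma subgradient_mul_sub_le (M : RegularKernel P B p) (h : IsKKT P B p θ l Y)
    (hs : s ∈ subdifferential (Phi P B p) θ) (hl' : 0 ≤ l') (hY' : Y' ∈ claims P B p)
    (hmax' : ∀ ω, Y' ω ∈ p.argmaxSet θ' (l' * Z ω)) :
    s * (θ' - θ) ≤ (θ' - θ) * ∫ ω, Y' ω ^ p.α ∂P + (l' - l) * (1 - price P B p Y') := by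
  have hlagrangian := M.integral_F_sub_mul_price_le hY' (mem_returns_iff.1 h.mem_returns).1
    h.mem_argmaxSet
  linarith [hs θ', M.Phi_le_dual hl' hY' hmax', M.integral_F_eq_add_mul hY' θ θ',
    M.le_Phi h.mem_returns θ, h.complementary]

/-- This comes from perturbing the parameter to `θ + ε σ` and the multiplier to `l + ε η`, and
letting `ε` decrease to `0`. -/
lemma subgradient_mul_le (M : RegularKernel P B p) (h : IsKKT P B p θ l Y)
    (hs : s ∈ subdifferential (Phi P B p) θ) (σ : ℝ) {η : ℝ} (hη : 0 < η) {W : Ω → ℝ}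
    (hW : ∀ᵐ ω ∂P,
      IsGreatest ((fun y => σ * y ^ p.α - η * Z ω * y) '' p.argmaxSet θ (l * Z ω)) (W ω)) :
    s * σ ≤ η + ∫ ω, W ω ∂P := by
  set slope : (Ω → ℝ) → Ω → ℝ := fun Y ω => σ * Y ω ^ p.α - η * Z ω * Y ω
  set v : ℝ → Ω → ℝ := fun ε => policy B p (θ + ε * σ) (l + ε * η)
  have hl : ∀ ε > 0, 0 < l + ε * η := fun ε hε =>
    add_pos_of_nonneg_of_pos h.multiplier_nonneg (mul_pos hε hη)
  have hvclaim : ∀ ε > 0, v ε ∈ claims P B p := fun ε hε => M.policy_mem_claims _ (hl ε hε)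
  have hvmem : ∀ ω, ∀ ε > 0, v ε ω ∈ p.argmaxSet (θ + ε * σ) (l * Z ω + ε * (η * Z ω)) :=
    fun ω ε hε => by simpa only [add_mul, mul_assoc] using M.policy_mem (θ + ε * σ) (hl ε hε) ω
  have hbound : ∀ ε > 0, s * σ ≤ η + ∫ ω, slope (v ε) ω ∂P := fun ε hε => by
    have := M.subgradient_mul_sub_le h hs (hl ε hε).le (hvclaim ε hε) (M.policy_mem _ (hl ε hε))
    rw [M.integral_slope (hvclaim ε hε)]
    exact le_of_mul_le_mul_left (by linarith) hε
  suffices hlim : Tendsto (fun ε => ∫ ω, slope (v ε) ω ∂P) (𝓝[>] 0) (𝓝 (∫ ω, W ω ∂P)) from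
    ge_of_tendsto (hlim.const_add η) (mem_of_superset self_mem_nhdsWithin hbound)
  have hY := (mem_returns_iff.1 h.mem_returns).1
  refine tendsto_integral_filter_of_dominated_convergence
    (fun ω => |slope Y ω| + |slope (v 1) ω|) ?_ ?_
    ((M.integrable_slope hY σ η).abs.add (M.integrable_slope (hvclaim 1 one_pos) σ η).abs) ?_
  · filter_upwards [self_mem_nhdsWithin] with ε hε
    exact (M.integrable_slope (hvclaim ε hε) σ η).aestronglyMeasurable
  · filter_upwards [Ioo_mem_nhdsGT one_pos] with ε hε
    refine ae_of_all _ fun ω => ?_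
    have hlower : slope Y ω ≤ slope (v ε) ω := Params.perturbed_slope_mono hε.1
      (by simpa only [zero_mul, add_zero] using h.mem_argmaxSet ω) (hvmem ω ε hε.1)
    have hupper : slope (v ε) ω ≤ slope (v 1) ω :=
      Params.perturbed_slope_mono hε.2 (hvmem ω ε hε.1) (hvmem ω 1 one_pos)
    exact (abs_le_max_abs_abs hlower hupper).trans
      (max_le_add_of_nonneg (abs_nonneg _) (abs_nonneg _))
  · filter_upwards [hW] with ω hω
    exact Params.tendsto_perturbed_slope M.toAdmissible (mul_pos hη (kernelZ_pos _ _ _ _)) hω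
      (hvmem ω)

lemma subgradient_mul_le_of_ae_unique (M : RegularKernel P B p) (h : IsKKT P B p θ l Y)
    (hunique : ∀ᵐ ω ∂P, p.argmaxSet θ (l * Z ω) ⊆ {Y ω})
    (hs : s ∈ subdifferential (Phi P B p) θ) (σ : ℝ) : s * σ ≤ σ * ∫ ω, Y ω ^ p.α ∂P := by
  have hY := mem_returns_iff.1 h.mem_returns
  have hprice : 0 ≤ price P B p Y :=
    integral_nonneg fun ω => mul_nonneg (kernelZ_pos _ _ _ _).le (hY.1.2.1 ω)
  refine le_of_forall_pos_le_add fun η hη => ?_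
  have hbound := M.subgradient_mul_le h hs σ hη (W := fun ω => σ * Y ω ^ p.α - η * Z ω * Y ω) (by
    filter_upwards [hunique] with ω hω
    rw [hω.antisymm (singleton_subset_iff.2 (h.mem_argmaxSet ω)), image_singleton]
    exact isGreatest_singleton)
  rw [M.integral_slope hY.1] at hbound
  linarith [mul_nonneg hη.le hprice]

lemma subdifferential_Phi_subset_singleton (M : RegularKernel P B p) (h : IsKKT P B p θ l Y)
    (hunique : ∀ᵐ ω ∂P, p.argmaxSet θ (l * Z ω) ⊆ {Y ω}) :
    subdifferential (Phi P B p) θ ⊆ {∫ ω, Y ω ^ p.α ∂P} := fun s hs => by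
  have hle := M.subgradient_mul_le_of_ae_unique h hunique hs 1
  have hge := M.subgradient_mul_le_of_ae_unique h hunique hs (-1)
  exact le_antisymm (by linarith) (by linarith)

/-- If the budget never binds, the maximizers for the multipliers `1 / (n + 1)` stay bounded, and
any limit point of them is a constant optimal payoff. -/
lemma exists_isKKT_zero (M : RegularKernel P B p)
    (h : ∀ l > 0, price P B p (policy B p θ l) < 1) : ∃ y, IsKKT P B p θ 0 fun _ => y := by
  have hbudget : ∀ x > 0, p.argmaxSel θ x * ∫ ω, Z ω ∂P ≤ 1 := fun x hx =>
    M.mul_integral_kernel_le fun c hc =>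
      (M.argmaxSel_mul_setIntegral_le θ hx hc).trans (h _ (div_pos hx hc)).le
  have hkernel : 0 < ∫ ω, Z ω ∂P :=
    integral_exp_pos M.integrable_kernel
  have hpos : ∀ n : ℕ, 0 < 1 / ((n : ℝ) + 1) := fun n => Nat.one_div_pos_of_nat
  obtain ⟨y, -, φ, hφ, hlim⟩ := isCompact_Icc.tendsto_subseq fun n : ℕ =>
    (⟨(M.argmaxSel_mem θ (hpos n)).1, (le_div_iff₀ hkernel).2 (hbudget _ (hpos n))⟩ :
      p.argmaxSel θ (1 / ((n : ℝ) + 1)) ∈ Icc 0 (1 / ∫ ω, Z ω ∂P))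
  have hy : y ∈ p.argmaxSet θ 0 := Params.mem_argmaxSet_of_tendsto M.α_mem.1 tendsto_const_nhds
    (tendsto_one_div_add_atTop_nhds_zero_nat.comp hφ.tendsto_atTop) hlim
    (Eventually.of_forall fun n => M.argmaxSel_mem θ (hpos (φ n)))
  refine ⟨y, IsKKT.of_multiplier_zero (M.const_mem_returns hy.1 ?_) fun _ => hy⟩
  exact le_of_tendsto (hlim.mul_const _) (Eventually.of_forall fun n => hbudget _ (hpos (φ n)))

lemma exists_isKKT_ae_unique (M : RegularKernel P B p)
    (hθ : (p.argmaxSet θ 0).Subsingleton) :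
    ∃ l Y, IsKKT P B p θ l Y ∧ ∀ᵐ ω ∂P, p.argmaxSet θ (l * Z ω) ⊆ {Y ω} := by
  by_cases h : ∃ l > 0, 1 ≤ price P B p (policy B p θ l)
  · obtain ⟨l₁, hl₁, h₁⟩ := h
    obtain ⟨l₂, hl₂, h₂⟩ := M.exists_price_policy_le_one θ
    obtain ⟨l, hl, hprice⟩ := isPreconnected_Ioi.intermediate_value hl₂ hl₁
      (M.continuousOn_price_policy θ) ⟨h₂, h₁⟩
    refine ⟨l, _, M.isKKT_policy hl hprice, ?_⟩
    filter_upwards [M.ae_continuousAt_argmaxSel θ hl] with ω hω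
    exact M.argmaxSet_subset_of_continuousAt (mul_pos hl (kernelZ_pos _ _ _ _)) hω
  · push Not at h
    obtain ⟨y, hy⟩ := M.exists_isKKT_zero h
    refine ⟨0, _, hy, ae_of_all _ fun ω y' hy' => ?_⟩
    rw [zero_mul] at hy'
    exact hθ hy' (by simpa only [zero_mul] using hy.mem_argmaxSet ω)

end RegularKernel

end KKT

section TwoMaximizers

variable {Ω : Type*} [mΩ : MeasurableSpace Ω] {P : Measure Ω} {B : ℝ≥0 → Ω → ℝ} {p : Params}
  {θ s y c : ℝ}

local notation "Z" => kernelZ B p p.τ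

/-- The digital payoff that pays `y` in the states where the pricing kernel is at most `c`. -/
def digital (B : ℝ≥0 → Ω → ℝ) (p : Params) (y c : ℝ) : Ω → ℝ :=
  {ω | kernelZ B p p.τ ω ≤ c}.indicator fun _ => y

namespace RegularKernel

lemma price_digital (M : RegularKernel P B p) (y c : ℝ) :
    price P B p (digital B p y c) = y * ∫ ω in {ω | Z ω ≤ c}, Z ω ∂P := by
  have hindicator : (fun ω => Z ω * digital B p y c ω) =
      {ω | Z ω ≤ c}.indicator fun ω => y * Z ω := by
    funext ω
    simp only [digital, ← indicator_mul_right, mul_comm]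
  rw [price, hindicator, integral_indicator₀ (M.nullMeasurableSet_kernel_le c), integral_const_mul]

lemma integral_digital_rpow [IsFiniteMeasure P] (M : RegularKernel P B p) (y c : ℝ) :
    ∫ ω, digital B p y c ω ^ p.α ∂P = y ^ p.α * P.real {ω | Z ω ≤ c} := by
  have hindicator : (fun ω => digital B p y c ω ^ p.α) =
      {ω | Z ω ≤ c}.indicator fun _ => y ^ p.α :=
    (indicator_comp_of_zero (g := fun x : ℝ => x ^ p.α) (Real.zero_rpow M.α_ne_zero)).symm
  rw [hindicator, integral_indicator₀ (M.nullMeasurableSet_kernel_le c), setIntegral_const,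
    smul_eq_mul, mul_comm]

lemma digital_mem_claims (M : RegularKernel P B p) (hy : 0 ≤ y) (c : ℝ) :
    digital B p y c ∈ claims P B p := by
  refine ⟨measurable_const.indicator ((measurable_kernelZ_augmented P B p p.τ) measurableSet_Iic),
    fun ω => indicator_nonneg (fun _ _ => hy) ω, ?_⟩
  simp only [digital, ← indicator_mul_right]
  exact (M.integrable_kernel.mul_const y).indicator₀ (M.nullMeasurableSet_kernel_le c)

lemma isKKT_zero (M : RegularKernel P B p) (h0 : (0 : ℝ) ∈ p.argmaxSet θ 0) :
    IsKKT P B p θ 0 fun _ => 0 :=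
  .of_multiplier_zero (M.const_mem_returns le_rfl (by simp)) fun _ => h0

lemma isKKT_digital (M : RegularKernel P B p) (h0 : (0 : ℝ) ∈ p.argmaxSet θ 0)
    (hy : y ∈ p.argmaxSet θ 0) (hbudget : y * ∫ ω in {ω | Z ω ≤ c}, Z ω ∂P ≤ 1) :
    IsKKT P B p θ 0 (digital B p y c) :=
  .of_multiplier_zero
    (mem_returns_iff.2 ⟨M.digital_mem_claims hy.1 c, (M.price_digital y c).trans_le hbudget⟩)
    fun ω => by
      rw [digital, indicator_apply]
      split_ifs <;> assumption

variable [IsProbabilityMeasure P]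

/-- The multiplier is perturbed at the rate `η = y ^ α / (y c)`, at which `y` is a better choice
than `0` exactly in the states with `Z ≤ c`. -/
lemma subgradient_le_digital (M : RegularKernel P B p) (h0 : (0 : ℝ) ∈ p.argmaxSet θ 0)
    (hy : y ∈ p.argmaxSet θ 0) (hpos : 0 < y) (hs : s ∈ subdifferential (Phi P B p) θ)
    (hc : 0 < c) :
    s ≤ y ^ p.α * P.real {ω | Z ω ≤ c} +
      y ^ p.α / (y * c) * (1 - y * ∫ ω in {ω | Z ω ≤ c}, Z ω ∂P) := by
  set η := y ^ p.α / (y * c) with hη_def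
  have hη : 0 < η := div_pos (Real.rpow_pos_of_pos hpos _) (mul_pos hpos hc)
  have hgain : ∀ z, 1 * y ^ p.α - η * z * y = η * y * (c - z) := fun z => by
    rw [hη_def]
    field_simp
  have hpair : p.argmaxSet θ 0 = {0, y} :=
    (M.argmaxSet_zero_subset_pair hy hpos).antisymm (by simp [insert_subset_iff, h0, hy])
  have hdigital := M.digital_mem_claims hpos.le c
  have hbound := M.subgradient_mul_le (M.isKKT_zero h0) hs 1 hη
    (W := fun ω => 1 * digital B p y c ω ^ p.α - η * Z ω * digital B p y c ω)
    (ae_of_all _ fun ω => by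
      have hzero : 1 * (0 : ℝ) ^ p.α - η * Z ω * 0 = 0 := by simp [Real.zero_rpow M.α_ne_zero]
      rw [zero_mul, hpair, image_pair]
      by_cases hω : Z ω ≤ c
      · rw [digital, indicator_of_mem (show ω ∈ {ω | Z ω ≤ c} from hω), hzero, hgain]
        have := mul_nonneg (mul_pos hη hpos).le (sub_nonneg.2 hω)
        exact ⟨by simp, by simpa [upperBounds] using this⟩
      · rw [digital, indicator_of_notMem (show ω ∉ {ω | Z ω ≤ c} from hω), hzero, hgain]
        have := mul_nonpos_of_nonneg_of_nonpos (mul_pos hη hpos).le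
          (sub_nonpos.2 (le_of_not_ge hω))
        exact ⟨by simp, by simpa [upperBounds] using this⟩)
  rw [M.integral_slope hdigital, M.integral_digital_rpow, M.price_digital] at hbound
  linarith

lemma subgradient_le_rpow (M : RegularKernel P B p) (h0 : (0 : ℝ) ∈ p.argmaxSet θ 0)
    (hy : y ∈ p.argmaxSet θ 0) (hpos : 0 < y) (hs : s ∈ subdifferential (Phi P B p) θ) :
    s ≤ y ^ p.α := by
  have hrpow := Real.rpow_pos_of_pos hpos p.α
  refine le_of_forall_pos_le_add fun ε hε => ?_
  have hbound := M.subgradient_le_digital h0 hy hpos hs (c := y ^ p.α / (y * ε)) (by positivity)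
  rw [show y ^ p.α / (y * (y ^ p.α / (y * ε))) = ε by field_simp] at hbound
  refine hbound.trans (add_le_add (mul_le_of_le_one_right hrpow.le measureReal_le_one)
    (mul_le_of_le_one_right hε.le (sub_le_self 1 (mul_nonneg hpos.le ?_))))
  exact integral_nonneg fun ω => (kernelZ_pos _ _ _ _).le

lemma mul_setIntegral_kernel_le_one (M : RegularKernel P B p) (h0 : (0 : ℝ) ∈ p.argmaxSet θ 0)
    (hy : y ∈ p.argmaxSet θ 0) (hpos : 0 < y) (hs : s ∈ subdifferential (Phi P B p) θ)
    (hc : 0 < c) (h : y ^ p.α * P.real {ω | Z ω ≤ c} ≤ s) :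
    y * ∫ ω in {ω | Z ω ≤ c}, Z ω ∂P ≤ 1 := by
  have hbound := M.subgradient_le_digital h0 hy hpos hs hc
  have hrate : 0 < y ^ p.α / (y * c) := by positivity
  exact sub_nonneg.1 (nonneg_of_mul_nonneg_right (by linarith) hrate)

/-- If `0` and `y` are both optimal, so is every affordable digital payoff, and these attain every
moment between `0` and `y ^ α` that the budget allows. -/
lemma exists_isKKT_integral_rpow_eq (M : RegularKernel P B p) (h0 : (0 : ℝ) ∈ p.argmaxSet θ 0)
    (hy : y ∈ p.argmaxSet θ 0) (hpos : 0 < y) (hs : s ∈ subdifferential (Phi P B p) θ) :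
    ∃ Y, IsKKT P B p θ 0 Y ∧ ∫ ω, Y ω ^ p.α ∂P = s := by
  have hrpow := Real.rpow_pos_of_pos hpos p.α
  rcases (M.subdifferential_Phi_subset_Icc θ hs).1.eq_or_lt with rfl | hs0
  · exact ⟨_, M.isKKT_zero h0, by simp [Real.zero_rpow M.α_ne_zero]⟩
  rcases (M.subgradient_le_rpow h0 hy hpos hs).lt_or_eq with hlt | rfl
  · obtain ⟨c, hc⟩ := exists_measureReal_setOf_le_eq M.aemeasurable_kernel M.measure_kernel_eq
      ⟨div_pos hs0 hrpow, (div_lt_one hrpow).2 hlt⟩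
    have hmoment : y ^ p.α * P.real {ω | Z ω ≤ c} = s := by rw [hc, mul_div_cancel₀ _ hrpow.ne']
    have hc0 : 0 < c := by
      by_contra! hle
      have hempty : {ω | Z ω ≤ c} = ∅ :=
        eq_empty_of_forall_notMem fun ω hω => (hω.trans hle).not_gt (kernelZ_pos _ _ _ _)
      rw [hempty, measureReal_empty] at hc
      exact (div_pos hs0 hrpow).ne hc
    exact ⟨_, M.isKKT_digital h0 hy
      (M.mul_setIntegral_kernel_le_one h0 hy hpos hs hc0 hmoment.le),
      (M.integral_digital_rpow y c).trans hmoment⟩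
  · have hbudget : y * ∫ ω, Z ω ∂P ≤ 1 := M.mul_integral_kernel_le fun c hc =>
      M.mul_setIntegral_kernel_le_one h0 hy hpos hs hc
        (mul_le_of_le_one_right hrpow.le measureReal_le_one)
    exact ⟨_, .of_multiplier_zero (M.const_mem_returns hpos.le hbudget) fun _ => hy, by simp⟩

end RegularKernel

end TwoMaximizers

section Moments

variable {Ω : Type*} [mΩ : MeasurableSpace Ω] {P : Measure Ω} [IsProbabilityMeasure P]
  {B : ℝ≥0 → Ω → ℝ} {p : Params} {θ : ℝ}

namespace RegularKernel

lemma exists_isKKT (M : RegularKernel P B p) (θ : ℝ) : ∃ l Y, IsKKT P B p θ l Y := by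
  by_cases hθ : (p.argmaxSet θ 0).Subsingleton
  · obtain ⟨l, Y, hY, -⟩ := M.exists_isKKT_ae_unique hθ
    exact ⟨l, Y, hY⟩
  · exact ⟨0, _, M.isKKT_zero (M.zero_mem_and_exists_pos_of_not_subsingleton hθ).1⟩

lemma subdifferential_Phi_nonempty (M : RegularKernel P B p) (θ : ℝ) :
    (subdifferential (Phi P B p) θ).Nonempty := by
  obtain ⟨l, Y, hY⟩ := M.exists_isKKT θ
  exact ⟨_, M.optimalMoments_subset_subdifferential θ
    (mem_image_of_mem _ (M.mem_optimizers_of_isKKT hY))⟩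

lemma optimalMoments_eq_subdifferential (M : RegularKernel P B p) (θ : ℝ) :
    optimalMoments P B p (fun y => p.F y θ) = subdifferential (Phi P B p) θ := by
  refine (M.optimalMoments_subset_subdifferential θ).antisymm fun s hs => ?_
  by_cases hθ : (p.argmaxSet θ 0).Subsingleton
  · obtain ⟨l, Y, hY, hunique⟩ := M.exists_isKKT_ae_unique hθ
    exact ⟨Y, M.mem_optimizers_of_isKKT hY,
      (M.subdifferential_Phi_subset_singleton hY hunique hs).symm⟩
  · obtain ⟨h0, y, hy, hpos⟩ := M.zero_mem_and_exists_pos_of_not_subsingleton hθ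
    obtain ⟨Y, hY, hmoment⟩ := M.exists_isKKT_integral_rpow_eq h0 hy hpos hs
    exact ⟨Y, M.mem_optimizers_of_isKKT hY, hmoment⟩

lemma subsingleton_subdifferential_Phi (M : RegularKernel P B p) (hθ : θ ≠ p.thetaLow) :
    (subdifferential (Phi P B p) θ).Subsingleton := by
  obtain ⟨l, Y, hY, hunique⟩ := M.exists_isKKT_ae_unique (M.subsingleton_argmaxSet_zero hθ)
  exact subsingleton_singleton.anti (M.subdifferential_Phi_subset_singleton hY hunique)

lemma G_eq_subdifferential (M : RegularKernel P B p) (ξ : ℝ) :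
    G P B p ξ = subdifferential (Phi P B p) (p.kappa ξ * thetaStar P B p (p.kappa ξ)) :=
  M.optimalMoments_eq_subdifferential _

lemma G_subset_Icc (M : RegularKernel P B p) (ξ : ℝ) :
    G P B p ξ ⊆ Icc 0 (Real.exp (p.h * p.τ)) :=
  (M.G_eq_subdifferential ξ).trans_subset (M.subdifferential_Phi_subset_Icc _)

end RegularKernel

end Moments

section FixedPoints

variable {Ω : Type*} [mΩ : MeasurableSpace Ω] {P : Measure Ω} [IsProbabilityMeasure P]
  {B : ℝ≥0 → Ω → ℝ} {p : Params} {κ κ' ξ ξ' : ℝ}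

namespace RegularKernel

lemma lipschitzWith_disc_mul_Phi (M : RegularKernel P B p) :
    LipschitzWith (p.disc * Real.exp (p.h * p.τ)).toNNReal fun θ => p.disc * Phi P B p θ := by
  have h := (lipschitzWith_smul p.disc).comp M.lipschitzWith_Phi
  rwa [← norm_toNNReal, Real.norm_of_nonneg p.disc_pos.le,
    ← Real.toNNReal_mul p.disc_pos.le] at h

lemma existsUnique_eq_disc_mul_Phi (M : RegularKernel P B p)
    (hde : p.disc * Real.exp (p.h * p.τ) < 1) (hκ : κ ∈ Icc (0 : ℝ) 1) :
    ∃! θ, θ = p.disc * Phi P B p (κ * θ) :=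
  existsUnique_eq_comp_mul (Real.toNNReal_lt_one.2 hde) M.lipschitzWith_disc_mul_Phi
    ((abs_of_nonneg hκ.1).trans_le hκ.2)

lemma thetaStar_eq (M : RegularKernel P B p) (hde : p.disc * Real.exp (p.h * p.τ) < 1)
    (hκ : κ ∈ Icc (0 : ℝ) 1) : thetaStar P B p κ = p.disc * Phi P B p (κ * thetaStar P B p κ) :=
  Classical.epsilon_spec (M.existsUnique_eq_disc_mul_Phi hde hκ).exists

lemma eq_thetaStar_iff (M : RegularKernel P B p) (hde : p.disc * Real.exp (p.h * p.τ) < 1)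
    (hκ : κ ∈ Icc (0 : ℝ) 1) (θ : ℝ) :
    θ = p.disc * Phi P B p (κ * θ) ↔ θ = thetaStar P B p κ :=
  ⟨fun h => (M.existsUnique_eq_disc_mul_Phi hde hκ).unique h (M.thetaStar_eq hde hκ),
    fun h => h ▸ M.thetaStar_eq hde hκ⟩

lemma continuousOn_thetaStar (M : RegularKernel P B p)
    (hde : p.disc * Real.exp (p.h * p.τ) < 1) : ContinuousOn (thetaStar P B p) (Icc 0 1) :=
  continuousOn_of_eq_comp_mul (Real.toNNReal_lt_one.2 hde) M.lipschitzWith_disc_mul_Phi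
    (fun _ hκ => (abs_of_nonneg hκ.1).trans_le hκ.2) fun _ hκ => M.thetaStar_eq hde hκ

lemma thetaStar_eq_zero (M : RegularKernel P B p) (hde : p.disc * Real.exp (p.h * p.τ) < 1)
    (h : thetaStar P B p 0 = 0) (hκ : κ ∈ Icc (0 : ℝ) 1) : thetaStar P B p κ = 0 := by
  have hfixed := M.thetaStar_eq hde (left_mem_Icc.2 zero_le_one)
  rw [h, zero_mul] at hfixed
  exact ((M.eq_thetaStar_iff hde hκ 0).1 (by rwa [mul_zero])).symm

lemma thetaStar_neg (M : RegularKernel P B p) (hde : p.disc * Real.exp (p.h * p.τ) < 1)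
    (h : thetaStar P B p 0 < 0) (hκ : κ ∈ Icc (0 : ℝ) 1) : thetaStar P B p κ < 0 := by
  refine neg_of_eq_comp_mul (Real.toNNReal_le_one.2 hde.le) M.lipschitzWith_disc_mul_Phi ?_
    ((abs_of_nonneg hκ.1).trans_le hκ.2) (M.thetaStar_eq hde hκ)
  rwa [M.thetaStar_eq hde (left_mem_Icc.2 zero_le_one), zero_mul] at h

lemma mul_thetaStar_lt_mul_thetaStar (M : RegularKernel P B p)
    (hde : p.disc * Real.exp (p.h * p.τ) < 1) (h : thetaStar P B p 0 < 0)
    (hκ : κ ∈ Icc (0 : ℝ) 1) (hκ' : κ' ∈ Icc (0 : ℝ) 1) (hlt : κ < κ') :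
    κ' * thetaStar P B p κ' < κ * thetaStar P B p κ :=
  mul_lt_mul_of_eq_comp_mul (Real.toNNReal_le_one.2 hde.le) M.lipschitzWith_disc_mul_Phi hκ' hlt
    (M.thetaStar_neg hde h hκ) (M.thetaStar_eq hde hκ) (M.thetaStar_eq hde hκ')

lemma exists_mem_G (M : RegularKernel P B p) (hde : p.disc * Real.exp (p.h * p.τ) < 1)
    (hβ : p.β ∈ Icc (0 : ℝ) 1) : ∃ ξ ∈ Icc (0 : ℝ) (Real.exp (p.h * p.τ)), ξ ∈ G P B p ξ := by
  have hdisc : ∀ ξ ∈ Icc (0 : ℝ) (Real.exp (p.h * p.τ)), p.disc * ξ < 1 := fun ξ hξ =>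
    Params.disc_mul_lt_one hde hξ.2
  have hκ : ContinuousOn p.kappa (Icc 0 (Real.exp (p.h * p.τ))) :=
    (Params.continuousOn_kappa hβ).mono hdisc
  have hκθ : ContinuousOn (fun ξ => p.kappa ξ * thetaStar P B p (p.kappa ξ))
      (Icc 0 (Real.exp (p.h * p.τ))) :=
    hκ.mul ((M.continuousOn_thetaStar hde).comp hκ fun ξ hξ =>
      Params.kappa_mem_Icc hβ (hdisc ξ hξ))
  simp only [M.G_eq_subdifferential]
  exact exists_mem_subdifferential_comp_self (Real.exp_pos _).le M.lipschitzWith_Phi.continuous hκθ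
    M.subdifferential_Phi_nonempty M.subdifferential_Phi_subset_Icc

lemma exists_optimalMoments_eq_singleton_and_mem_G_iff (M : RegularKernel P B p)
    (hde : p.disc * Real.exp (p.h * p.τ) < 1) (hβ : p.β ∈ Icc (0 : ℝ) 1)
    (h : thetaStar P B p 0 = 0) :
    ∃ ξ₀ ∈ Icc (0 : ℝ) (Real.exp (p.h * p.τ)),
      optimalMoments P B p (fun y => p.U (y - p.γ)) = {ξ₀} ∧
      ∀ ξ ∈ Icc (0 : ℝ) (Real.exp (p.h * p.τ)), ξ ∈ G P B p ξ ↔ ξ = ξ₀ := by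
  obtain ⟨ξ₀, hξ₀⟩ := M.subdifferential_Phi_nonempty 0
  have hsingleton : subdifferential (Phi P B p) 0 = {ξ₀} :=
    (M.subsingleton_subdifferential_Phi (Params.thetaLow_neg M.k_nonneg).ne').eq_singleton_of_mem
      hξ₀
  refine ⟨ξ₀, M.subdifferential_Phi_subset_Icc 0 hξ₀, ?_, fun ξ hξ => ?_⟩
  · have hU : (fun y => p.U (y - p.γ)) = fun y => p.F y 0 := by simp [Params.F]
    rw [hU, M.optimalMoments_eq_subdifferential, hsingleton]
  · have hκ := Params.kappa_mem_Icc hβ (Params.disc_mul_lt_one hde hξ.2)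
    rw [M.G_eq_subdifferential, M.thetaStar_eq_zero hde h hκ, mul_zero, hsingleton,
      mem_singleton_iff]

lemma le_of_mem_G (M : RegularKernel P B p) (hde : p.disc * Real.exp (p.h * p.τ) < 1)
    (hβ : p.β ∈ Icc (0 : ℝ) 1) (hneg : thetaStar P B p 0 < 0)
    (hlow : p.β < 1 ∨ thetaStar P B p 1 ≠ p.thetaLow) (hξ : ξ ∈ G P B p ξ)
    (hξ' : ξ' ∈ G P B p ξ') : ξ' ≤ ξ := by
  by_contra! hlt
  have hdisc := Params.disc_mul_lt_one hde (M.G_subset_Icc ξ hξ).2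
  have hdisc' := Params.disc_mul_lt_one hde (M.G_subset_Icc ξ' hξ').2
  rw [M.G_eq_subdifferential] at hξ hξ'
  rcases hβ.1.eq_or_lt with h0 | h0
  · have hκ : ∀ ξ, p.kappa ξ = 0 := fun ξ => by simp [Params.kappa, ← h0]
    rw [hκ, zero_mul] at hξ hξ'
    exact hlt.ne (M.subsingleton_subdifferential_Phi (Params.thetaLow_neg M.k_nonneg).ne' hξ hξ')
  rcases hβ.2.eq_or_lt with h1 | h1
  · have hκ : ∀ ξ, p.kappa ξ = 1 := fun ξ => by simp [Params.kappa, h1]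
    rw [hκ, one_mul] at hξ hξ'
    exact hlt.ne (M.subsingleton_subdifferential_Phi (hlow.resolve_left h1.not_lt) hξ hξ')
  · have hθ := M.mul_thetaStar_lt_mul_thetaStar hde hneg (Params.kappa_mem_Icc hβ hdisc)
      (Params.kappa_mem_Icc hβ hdisc') (Params.kappa_lt_kappa ⟨h0, h1⟩ hdisc' hlt)
    exact hlt.not_ge (subdifferential_mono hθ hξ' hξ)

lemma existsUnique_mem_G (M : RegularKernel P B p) (hde : p.disc * Real.exp (p.h * p.τ) < 1)
    (hβ : p.β ∈ Icc (0 : ℝ) 1) (hneg : thetaStar P B p 0 < 0)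
    (hlow : p.β < 1 ∨ thetaStar P B p 1 ≠ p.thetaLow) :
    ∃! ξ : ℝ, ξ ∈ Icc (0 : ℝ) (Real.exp (p.h * p.τ)) ∧ ξ ∈ G P B p ξ := by
  obtain ⟨ξ, hξ, hG⟩ := M.exists_mem_G hde hβ
  exact ⟨ξ, ⟨hξ, hG⟩, fun ξ' hξ' => le_antisymm (M.le_of_mem_G hde hβ hneg hlow hG hξ'.2)
    (M.le_of_mem_G hde hβ hneg hlow hξ'.2 hG)⟩

end RegularKernel

end FixedPoints

end PresentBias

end

open PresentBias in
theorem mainTheorem4_general {Ω : Type*} [MeasurableSpace Ω] (P : Measure Ω)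
    [IsProbabilityMeasure P] (B : ℝ≥0 → Ω → ℝ) (p : Params)
    (hB : ∀ t ≤ p.τ, AEMeasurable (B t) P) (hlaw : HasLaw (B p.τ) (gaussianReal 0 p.τ) P)
    (hφ : p.φ ≠ 0) (hτ : 0 < p.τ) (hα : p.α ∈ Ioo (0 : ℝ) 1) (hk : 0 ≤ p.k) (hγ : 0 < p.γ)
    (hβ : p.β ∈ Icc (0 : ℝ) 1) (hδh : p.h < p.δ) :
    (∀ κ ∈ Icc (0 : ℝ) 1, ∀ θ : ℝ,
      θ = p.disc * Phi P B p (κ * θ) ↔ θ = thetaStar P B p κ) ∧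
    (∀ ξ ∈ Icc (0 : ℝ) (Real.exp (p.h * p.τ)),
      p.kappa ξ ∈ Icc (0 : ℝ) 1 ∧ G P B p ξ ⊆ Icc 0 (Real.exp (p.h * p.τ))) ∧
    (∃ ξ ∈ Icc (0 : ℝ) (Real.exp (p.h * p.τ)), ξ ∈ G P B p ξ) ∧
    (thetaStar P B p 0 = 0 →
      ∃ ξ₀ ∈ Icc (0 : ℝ) (Real.exp (p.h * p.τ)),
        optimalMoments P B p (fun y => p.U (y - p.γ)) = {ξ₀} ∧
        ∀ ξ ∈ Icc (0 : ℝ) (Real.exp (p.h * p.τ)), ξ ∈ G P B p ξ ↔ ξ = ξ₀) ∧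
    (thetaStar P B p 0 < 0 → (p.β < 1 ∨ thetaStar P B p 1 ≠ p.thetaLow) →
      ∃! ξ : ℝ, ξ ∈ Icc (0 : ℝ) (Real.exp (p.h * p.τ)) ∧ ξ ∈ G P B p ξ) := by
  have hp : p.Admissible := ⟨hα, hk, hγ⟩
  have M : RegularKernel P B p := hp.regularKernel hB hlaw hφ hτ.ne'
  have hde := Params.disc_mul_exp_lt_one hτ hδh
  refine ⟨fun κ hκ => M.eq_thetaStar_iff hde hκ, fun ξ hξ => ⟨?_, M.G_subset_Icc ξ⟩,
    M.exists_mem_G hde hβ, M.exists_optimalMoments_eq_singleton_and_mem_G_iff hde hβ,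
    M.existsUnique_mem_G hde hβ⟩
  exact Params.kappa_mem_Icc hβ (Params.disc_mul_lt_one hde hξ.2)

open PresentBias in
theorem mainTheorem4 {Ω : Type*} [MeasurableSpace Ω] (P : Measure Ω) [IsProbabilityMeasure P]
    [P.IsComplete] (B : ℝ≥0 → Ω → ℝ) (hB : IsBrownianReal B P) (p : Params)
    (hσ : 0 < p.σ) (hφ : p.φ ≠ 0) (hτ : 0 < p.τ) (hα : p.α ∈ Ioo (0 : ℝ) 1) (hk : 0 ≤ p.k)
    (hγ : 0 < p.γ) (hδ : 0 < p.δ) (hβ : p.β ∈ Icc (0 : ℝ) 1) (hδh : p.h < p.δ) :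
    -- `θ*` is well defined on `[0,1]`
    (∀ κ ∈ Icc (0 : ℝ) 1, ∀ θ : ℝ,
      θ = p.disc * Phi P B p (κ * θ) ↔ θ = thetaStar P B p κ) ∧
    -- `G` is well defined as a set-valued map from `[0, e^{hτ}]` to subsets of `[0, e^{hτ}]`
    (∀ ξ ∈ Icc (0 : ℝ) (Real.exp (p.h * p.τ)),
      p.kappa ξ ∈ Icc (0 : ℝ) 1 ∧ G P B p ξ ⊆ Icc 0 (Real.exp (p.h * p.τ))) ∧
    -- existence of a fixed point, whatever the sign of `θ*(0)`
    (∃ ξ ∈ Icc (0 : ℝ) (Real.exp (p.h * p.τ)), ξ ∈ G P B p ξ) ∧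
    -- uniqueness and explicit value if `θ*(0) = 0`
    (thetaStar P B p 0 = 0 →
      ∃ ξ₀ ∈ Icc (0 : ℝ) (Real.exp (p.h * p.τ)),
        optimalMoments P B p (fun y => p.U (y - p.γ)) = {ξ₀} ∧
        ∀ ξ ∈ Icc (0 : ℝ) (Real.exp (p.h * p.τ)), ξ ∈ G P B p ξ ↔ ξ = ξ₀) ∧
    -- uniqueness if `θ*(0) < 0`
    (thetaStar P B p 0 < 0 → (p.β < 1 ∨ thetaStar P B p 1 ≠ p.thetaLow) →
      ∃! ξ : ℝ, ξ ∈ Icc (0 : ℝ) (Real.exp (p.h * p.τ)) ∧ ξ ∈ G P B p ξ) :=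
  mainTheorem4_general P B p (fun t _ => hB.toIsPreBrownianReal.aemeasurable t)
    (hB.toIsPreBrownianReal.hasLaw_eval p.τ) hφ hτ hα hk hγ hβ hδh
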